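/- Let $n_1,n_2,n_3\ge 1$ be integers, and let $\sigma(x)=(\max\{x_k,0\})_k$ denote the ReLU function, applied to each component of a vector. Let $\mathcal Y_{n_1,n_2,n_3}$ be the set of all functions $f_4:\mathbb R\to\mathbb R$ of the form $$f_4(t)=\mathbf A^{(4)}\sigma(\mathbf F_3(t))+t\,c^{(4)}+b^{(4)},\qquad \mathbf F_\ell(t)=\mathbf A^{(\ell)}\sigma(\mathbf F_{\ell-1}(t))+t\,\mathbf c^{(\ell)}+\mathbf b^{(\ell)}\ (\ell=2,3),\qquad \mathbf F_1(t)=t\,\mathbf A^{(1)}+\mathbf b^{(1)},$$ with real matrices $\mathbf A^{(\ell)}\in\mathbb R^{n_\ell\times n_{\ell-1}}$ for $\ell=1,\dots,4$ (where $n_0=n_4=1$), vectors $\mathbf b^{(\ell)}\in\mathbb R^{n_\ell}$ for $\ell=1,2,3$ and $\mathbf c^{(\ell)}\in\mathbb R^{n_\ell}$ for $\ell=2,3$, and $c^{(4)},b^{(4)}\in\mathbb R$. Then every $f_4\in\mathcal Y_{n_1,n_2,n_3}$ can be represented in the normalized form $$f_4(t)=c^{(4)}t+b^{(4)}+\mathbf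 A^{(4)}\sigma\Big(\mathbf A^{(3)}\sigma\big(\mathbf A^{(2)}\sigma(t\mathbf 1+\mathbf b^{(1)})+t\,\mathbf c^{(2)}+\mathbf b^{(2)}\big)+t\,\mathbf c^{(3)}+\mathbf b^{(3)}\Big)$$ with sign vectors $\mathbf c^{(2)}\in\{-1,0,1\}^{n_2}$, $\mathbf c^{(3)}\in\{-1,0,1\}^{n_3}$, where $\mathbf 1\in\mathbb R^{n_1}$ is the all-ones vector. The real parameters of this form are the entries of $\mathbf b^{(1)},\mathbf A^{(2)},\mathbf b^{(2)},\mathbf A^{(3)},\mathbf b^{(3)},\mathbf A^{(4)},c^{(4)},b^{(4)}$; their number is $n_1+(n_1+1)n_2+(n_2+1)n_3+n_3+2$. Moreover, these real parameters are independent: if one or more of them are fixed to arbitrarily prescribed real constants, then the set $\tilde{\mathcal Y}_{n_1,n_2,n_3}$ of all functions of the normalized form with these fixed values (the remaining real parameters and the sign vectors being free) satisfies $\tilde{\mathcal Y}_{n_1,n_2,n_3}\subsetneq\mathcal Y_{n_1,n_2,n_3}$. -/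

import Mathlib

open scoped Matrix

/-- The rectified linear unit, applied to each component of a vector. -/
def reluVec {n : ℕ} (x : Fin n → ℝ) : Fin n → ℝ := fun k => max (x k) 0

/-- One layer after the first: from the vector `x` of the preceding layer (before activation) and
the input `t` (source channel) it computes `A σ(x) + t c + b`. -/
def layer {m n : ℕ} (A : Matrix (Fin n) (Fin m) ℝ) (c b : Fin n → ℝ) (t : ℝ) (x : Fin m → ℝ) :
    Fin n → ℝ :=
  A *ᵥ reluVec x + t • c + b

/-- The function `ℝ → ℝ` computed by a ReLU network with source channel and three hidden layers of
widths `n₁, n₂, n₃`. The column `A₁ ∈ ℝ^{n₁ × 1}` and the row `A₄ ∈ ℝ^{1 × n₃}` are written as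
vectors. -/
def network {n₁ n₂ n₃ : ℕ} (A₁ b₁ : Fin n₁ → ℝ)
    (A₂ : Matrix (Fin n₂) (Fin n₁) ℝ) (c₂ b₂ : Fin n₂ → ℝ)
    (A₃ : Matrix (Fin n₃) (Fin n₂) ℝ) (c₃ b₃ : Fin n₃ → ℝ)
    (A₄ : Fin n₃ → ℝ) (c₄ b₄ : ℝ) : ℝ → ℝ := fun t =>
  A₄ ⬝ᵥ reluVec (layer A₃ c₃ b₃ t (layer A₂ c₂ b₂ t (t • A₁ + b₁))) + t * c₄ + b₄

/-- The model `Y_{n₁,n₂,n₃}`: all functions computed by such networks. -/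
def reluModel (n₁ n₂ n₃ : ℕ) : Set (ℝ → ℝ) :=
  {f | ∃ (A₁ b₁ : Fin n₁ → ℝ)
      (A₂ : Matrix (Fin n₂) (Fin n₁) ℝ) (c₂ b₂ : Fin n₂ → ℝ)
      (A₃ : Matrix (Fin n₃) (Fin n₂) ℝ) (c₃ b₃ : Fin n₃ → ℝ)
      (A₄ : Fin n₃ → ℝ) (c₄ b₄ : ℝ),
      f = network A₁ b₁ A₂ c₂ b₂ A₃ c₃ b₃ A₄ c₄ b₄}

/-- The names of the real parameters of the normalized network, one for each entry of
`b₁, A₂, b₂, A₃, b₃, A₄, c₄, b₄`. -/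
inductive RealParam (n₁ n₂ n₃ : ℕ) : Type
  | b₁ (k : Fin n₁)
  | A₂ (j : Fin n₂) (k : Fin n₁)
  | b₂ (j : Fin n₂)
  | A₃ (r : Fin n₃) (j : Fin n₂)
  | b₃ (r : Fin n₃)
  | A₄ (r : Fin n₃)
  | c₄
  | b₄

/-- The normalized network: `A₁` is the all-ones vector, `c₂` and `c₃` are the sign vectors
`s₂` and `s₃` with entries in `{-1, 0, 1}`, and all other entries are the real parameters `θ`. -/
def normalizedNetwork {n₁ n₂ n₃ : ℕ} (s₂ : Fin n₂ → SignType) (s₃ : Fin n₃ → SignType)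
    (θ : RealParam n₁ n₂ n₃ → ℝ) : ℝ → ℝ :=
  network (fun _ => 1) (fun k => θ (.b₁ k))
    (Matrix.of fun j k => θ (.A₂ j k)) (fun j => ((s₂ j : SignType) : ℝ)) (fun j => θ (.b₂ j))
    (Matrix.of fun r j => θ (.A₃ r j)) (fun r => ((s₃ r : SignType) : ℝ)) (fun r => θ (.b₃ r))
    (fun r => θ (.A₄ r)) (θ .c₄) (θ .b₄)

/-- The restricted model: the real parameters named in `S` are fixed to the prescribed values `v`;
the remaining real parameters and the sign vectors are free. -/
def restrictedModel {n₁ n₂ n₃ : ℕ} (S : Set (RealParam n₁ n₂ n₃)) (v : S → ℝ) :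
    Set (ℝ → ℝ) :=
  {f | ∃ (s₂ : Fin n₂ → SignType) (s₃ : Fin n₃ → SignType) (θ : RealParam n₁ n₂ n₃ → ℝ),
      (∀ p : S, θ p = v p) ∧ f = normalizedNetwork s₂ s₃ θ}

/-! The normal form rests on max(y, 0) = y + max(-y, 0) and on positive homogeneity. A first-layer
neuron is a multiple of a unit-slope ReLU plus an affine function, which the source channel absorbs;
in later layers positive factors move into the next matrix.

Properness is a dimension argument (`exists_notMem_of_fixed_param`). For fixed activation patterns
the output at a given input is a polynomial in the parameters. Suppose that at some θ the parameter
derivatives at regular inputs have trivial common kernel. Then finitely many inputs suffice, and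
evaluation there followed by a linear left inverse is a self-map of parameter space with derivative
the identity at θ, so its range is a neighbourhood. If every network could be written with one
parameter fixed, this range would lie in finitely many smooth images of a hyperplane, a null set.

Such a θ is `witness`, a sawtooth of a sawtooth. For a vector in the common kernel, the derivative
of the output is affine in the input on each piece, hence vanishes for both patterns next to an
isolated kink; subtracting leaves a relation about the one neuron that switches (`kink₂_relation`,
`kink₃_relation`). The witness has enough isolated kinks for these relations to kill every
coordinate (`eq_zero_of_dgatedNetwork_witness`). -/

/-! ### Reduction to the normal form -/

/-- A ReLU of a nonconstant affine function is a multiple of a shifted ReLU plus an affine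
function. -/
lemma relu_affine_eq (a b : ℝ) :
    ∃ b' α c d : ℝ, ∀ t : ℝ, max (t * a + b) 0 = α * max (t + b') 0 + t * c + d := by
  rcases lt_trichotomy a 0 with ha | rfl | ha
  · have hne := ha.ne
    -- With y = t * a + b, this is max(y, 0) = y + max(-y, 0), where -y has positive slope -a.
    refine ⟨b / a, -a, a, b, fun t => ?_⟩
    have h : t * a + b = a * (t + b / a) := by field_simp
    have h' : a * (b / a) = b := by field_simp
    rw [h]
    rcases le_total 0 (t + b / a) with h0 | h0
    · rw [max_eq_left h0, max_eq_right (mul_nonpos_of_nonpos_of_nonneg ha.le h0)]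
      linear_combination h'
    · rw [max_eq_right h0, max_eq_left (mul_nonneg_of_nonpos_of_nonpos ha.le h0)]
      linear_combination h'
  · exact ⟨0, 0, 0, max b 0, fun t => by simp⟩
  · refine ⟨b / a, a, 0, 0, fun t => ?_⟩
    have h : t * a + b = a * (t + b / a) := by field_simp
    rw [h, ← mul_zero a, ← mul_max_of_nonneg _ _ ha.le, mul_zero]
    ring

lemma layer_apply {m n : ℕ} (A : Matrix (Fin n) (Fin m) ℝ) (c b : Fin n → ℝ) (t : ℝ)
    (x : Fin m → ℝ) (j : Fin n) :
    layer A c b t x j = ∑ k, A j k * max (x k) 0 + t * c j + b j := by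
  simp [layer, Matrix.mulVec, dotProduct, reluVec]

/-- The weights of the first layer can be normalized to one. -/
lemma exists_layer_eq_layer_one {m n : ℕ} (a b : Fin m → ℝ) (A : Matrix (Fin n) (Fin m) ℝ)
    (c d : Fin n → ℝ) :
    ∃ (b' : Fin m → ℝ) (A' : Matrix (Fin n) (Fin m) ℝ) (c' d' : Fin n → ℝ), ∀ t : ℝ,
      layer A c d t (t • a + b) = layer A' c' d' t (t • (fun _ => 1) + b') := by
  choose b' α γ δ h using fun k => relu_affine_eq (a k) (b k)
  refine ⟨b', Matrix.of fun j k => A j k * α k, fun j => c j + ∑ k, A j k * γ k,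
    fun j => d j + ∑ k, A j k * δ k, fun t => funext fun j => ?_⟩
  simp only [layer_apply, Pi.add_apply, Pi.smul_apply, smul_eq_mul, h, mul_one, Matrix.of_apply,
    mul_add, Finset.sum_add_distrib, Finset.mul_sum]
  have h1 : ∀ k, A j k * (α k * max (t + b' k) 0) = A j k * α k * max (t + b' k) 0 :=
    fun k => by ring
  have h2 : ∀ k, A j k * (t * γ k) = t * (A j k * γ k) := fun k => by ring
  simp only [h1, h2]
  ring

/-- Every real number is a positive multiple of its sign. -/
lemma exists_pos_mul_sign (c : ℝ) : ∃ (l : ℝ) (s : SignType), 0 < l ∧ c = l * (s : ℝ) := by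
  rcases lt_trichotomy c 0 with hc | rfl | hc
  · exact ⟨-c, -1, by linarith, by simp⟩
  · exact ⟨1, 0, by simp, by simp⟩
  · exact ⟨c, 1, hc, by simp⟩

/-- The source weights of a hidden layer can be normalized to signs, at the cost of positive
factors in the output. -/
lemma exists_reluVec_layer_eq {m n : ℕ} (A : Matrix (Fin n) (Fin m) ℝ) (c b : Fin n → ℝ) :
    ∃ (A' : Matrix (Fin n) (Fin m) ℝ) (s : Fin n → SignType) (b' l : Fin n → ℝ), ∀ t x j,
      reluVec (layer A c b t x) j
        = l j * reluVec (layer A' (fun i => ((s i : SignType) : ℝ)) b' t x) j := by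
  choose l s hl hs using fun j => exists_pos_mul_sign (c j)
  refine ⟨Matrix.of fun j k => A j k / l j, s, fun j => b j / l j, l, fun t x j => ?_⟩
  have hne := (hl j).ne'
  simp only [reluVec, layer_apply, Matrix.of_apply]
  rw [mul_max_of_nonneg _ _ (hl j).le, mul_zero]
  congr 1
  simp only [mul_add, Finset.mul_sum]
  congr 1
  · congr 1
    · exact Finset.sum_congr rfl fun k _ => by field_simp
    · conv_lhs => rw [hs j]
      ring
  · field_simp

/-- Absorbs the positive factors left by `exists_reluVec_layer_eq` into the columns of the next
matrix. -/
lemma exists_layer_scale {m n : ℕ} (A : Matrix (Fin n) (Fin m) ℝ) (c b : Fin n → ℝ)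
    (l : Fin m → ℝ) :
    ∃ A' : Matrix (Fin n) (Fin m) ℝ, ∀ t x y, (∀ k, reluVec x k = l k * reluVec y k) →
      layer A c b t x = layer A' c b t y := by
  refine ⟨Matrix.of fun j k => A j k * l k, fun t x y h => funext fun j => ?_⟩
  simp only [reluVec] at h
  simp only [layer_apply, Matrix.of_apply, h, mul_assoc]

theorem exists_eq_normalizedNetwork {n₁ n₂ n₃ : ℕ} {f : ℝ → ℝ} (hf : f ∈ reluModel n₁ n₂ n₃) :
    ∃ (s₂ : Fin n₂ → SignType) (s₃ : Fin n₃ → SignType) (θ : RealParam n₁ n₂ n₃ → ℝ),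
      f = normalizedNetwork s₂ s₃ θ := by
  obtain ⟨A₁, b₁, A₂, c₂, b₂, A₃, c₃, b₃, A₄, c₄, b₄, rfl⟩ := hf
  obtain ⟨b₁', A₂', c₂', b₂', h₁⟩ := exists_layer_eq_layer_one A₁ b₁ A₂ c₂ b₂
  obtain ⟨A₂'', s₂, b₂'', l₂, h₂⟩ := exists_reluVec_layer_eq A₂' c₂' b₂'
  obtain ⟨A₃', h₃⟩ := exists_layer_scale A₃ c₃ b₃ l₂
  obtain ⟨A₃'', s₃, b₃', l₃, h₄⟩ := exists_reluVec_layer_eq A₃' c₃ b₃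
  refine ⟨s₂, s₃, fun
    | .b₁ k => b₁' k
    | .A₂ j k => A₂'' j k
    | .b₂ j => b₂'' j
    | .A₃ r j => A₃'' r j
    | .b₃ r => b₃' r
    | .A₄ r => A₄ r * l₃ r
    | .c₄ => c₄
    | .b₄ => b₄, funext fun t => ?_⟩
  simp only [normalizedNetwork, network]
  rw [h₁, h₃ t _ _ (h₂ t _)]
  simp only [dotProduct, h₄, mul_assoc]
  rfl

lemma normalizedNetwork_mem_reluModel {n₁ n₂ n₃ : ℕ} (s₂ : Fin n₂ → SignType)
    (s₃ : Fin n₃ → SignType) (θ : RealParam n₁ n₂ n₃ → ℝ) :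
    normalizedNetwork s₂ s₃ θ ∈ reluModel n₁ n₂ n₃ :=
  ⟨_, _, _, _, _, _, _, _, _, _, _, rfl⟩

/-! ### Counting the parameters -/

namespace RealParam

variable {n₁ n₂ n₃ : ℕ}

/-- The parameters, layer by layer. -/
def equivSum : RealParam n₁ n₂ n₃ ≃
    Fin n₁ ⊕ (Fin n₂ × Fin n₁) ⊕ Fin n₂ ⊕ (Fin n₃ × Fin n₂) ⊕ Fin n₃ ⊕ Fin n₃ ⊕ Unit ⊕ Unit where
  toFun
    | .b₁ k => .inl k
    | .A₂ j k => .inr (.inl (j, k))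
    | .b₂ j => .inr (.inr (.inl j))
    | .A₃ r j => .inr (.inr (.inr (.inl (r, j))))
    | .b₃ r => .inr (.inr (.inr (.inr (.inl r))))
    | .A₄ r => .inr (.inr (.inr (.inr (.inr (.inl r)))))
    | .c₄ => .inr (.inr (.inr (.inr (.inr (.inr (.inl ()))))))
    | .b₄ => .inr (.inr (.inr (.inr (.inr (.inr (.inr ()))))))
  invFun
    | .inl k => .b₁ k
    | .inr (.inl (j, k)) => .A₂ j k
    | .inr (.inr (.inl j)) => .b₂ j
    | .inr (.inr (.inr (.inl (r, j)))) => .A₃ r j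
    | .inr (.inr (.inr (.inr (.inl r)))) => .b₃ r
    | .inr (.inr (.inr (.inr (.inr (.inl r))))) => .A₄ r
    | .inr (.inr (.inr (.inr (.inr (.inr (.inl _)))))) => .c₄
    | .inr (.inr (.inr (.inr (.inr (.inr (.inr _)))))) => .b₄
  left_inv p := by cases p <;> rfl
  right_inv p := by
    rcases p with k | ⟨j, k⟩ | j | ⟨r, j⟩ | r | r | _ | _ <;> rfl

noncomputable instance : Fintype (RealParam n₁ n₂ n₃) := Fintype.ofEquiv _ equivSum.symm

lemma card_eq : Nat.card (RealParam n₁ n₂ n₃) = n₁ + (n₁ + 1) * n₂ + (n₂ + 1) * n₃ + n₃ + 2 := by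
  rw [Nat.card_congr equivSum, Nat.card_eq_fintype_card]
  simp only [Fintype.card_sum, Fintype.card_prod, Fintype.card_fin, Fintype.card_unit]
  ring

end RealParam

/-! ### Networks with frozen activation patterns and their derivatives -/

open Filter Topology MeasureTheory

section Gated

variable {n₁ n₂ n₃ : ℕ}

/-- The indicator of an activation bit. -/
def gate (b : Bool) : ℝ := if b then 1 else 0

@[simp] lemma gate_true : gate true = 1 := rfl

@[simp] lemma gate_false : gate false = 0 := rfl

lemma gate_decide_mul (x : ℝ) : gate (decide (0 < x)) * x = max x 0 := by
  rcases lt_or_ge 0 x with h | h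
  · simp [h, h.le]
  · simp [h, not_lt.2 h]

/-- Preactivations of the second layer when the activation pattern of the first layer is `p₁`. -/
def pre₂ (s₂ : Fin n₂ → SignType) (θ : RealParam n₁ n₂ n₃ → ℝ) (p₁ : Fin n₁ → Bool) (t : ℝ)
    (j : Fin n₂) : ℝ :=
  ∑ k, θ (.A₂ j k) * (gate (p₁ k) * (t + θ (.b₁ k))) + t * ((s₂ j : SignType) : ℝ) + θ (.b₂ j)

/-- Preactivations of the third layer when the activation patterns of the first two layers are
`p₁` and `p₂`. -/
def pre₃ (s₂ : Fin n₂ → SignType) (s₃ : Fin n₃ → SignType) (θ : RealParam n₁ n₂ n₃ → ℝ)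
    (p₁ : Fin n₁ → Bool) (p₂ : Fin n₂ → Bool) (t : ℝ) (r : Fin n₃) : ℝ :=
  ∑ j, θ (.A₃ r j) * (gate (p₂ j) * pre₂ s₂ θ p₁ t j) + t * ((s₃ r : SignType) : ℝ) + θ (.b₃ r)

/-- Output of the normalized network when the activation patterns are `p₁`, `p₂`, `p₃`: a
polynomial in the parameters and an affine function of the input. -/
def gatedNetwork (s₂ : Fin n₂ → SignType) (s₃ : Fin n₃ → SignType) (θ : RealParam n₁ n₂ n₃ → ℝ)
    (p₁ : Fin n₁ → Bool) (p₂ : Fin n₂ → Bool) (p₃ : Fin n₃ → Bool) (t : ℝ) : ℝ :=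
  ∑ r, θ (.A₄ r) * (gate (p₃ r) * pre₃ s₂ s₃ θ p₁ p₂ t r) + t * θ .c₄ + θ .b₄

/-- Activation pattern of the first layer at the input `t`. -/
noncomputable def act₁ (θ : RealParam n₁ n₂ n₃ → ℝ) (t : ℝ) (k : Fin n₁) : Bool :=
  decide (0 < t + θ (.b₁ k))

/-- Activation pattern of the second layer at the input `t`. -/
noncomputable def act₂ (s₂ : Fin n₂ → SignType) (θ : RealParam n₁ n₂ n₃ → ℝ) (t : ℝ)
    (j : Fin n₂) : Bool :=
  decide (0 < pre₂ s₂ θ (act₁ θ t) t j)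

/-- Activation pattern of the third layer at the input `t`. -/
noncomputable def act₃ (s₂ : Fin n₂ → SignType) (s₃ : Fin n₃ → SignType)
    (θ : RealParam n₁ n₂ n₃ → ℝ) (t : ℝ) (r : Fin n₃) : Bool :=
  decide (0 < pre₃ s₂ s₃ θ (act₁ θ t) (act₂ s₂ θ t) t r)

lemma pre₂_act (s₂ : Fin n₂ → SignType) (θ : RealParam n₁ n₂ n₃ → ℝ) (t : ℝ) (j : Fin n₂) :
    pre₂ s₂ θ (act₁ θ t) t j
      = ∑ k, θ (.A₂ j k) * max (t + θ (.b₁ k)) 0 + t * ((s₂ j : SignType) : ℝ) + θ (.b₂ j) := by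
  simp only [pre₂, act₁, gate_decide_mul]

lemma pre₃_act (s₂ : Fin n₂ → SignType) (s₃ : Fin n₃ → SignType) (θ : RealParam n₁ n₂ n₃ → ℝ)
    (t : ℝ) (r : Fin n₃) :
    pre₃ s₂ s₃ θ (act₁ θ t) (act₂ s₂ θ t) t r
      = ∑ j, θ (.A₃ r j) * max (pre₂ s₂ θ (act₁ θ t) t j) 0 + t * ((s₃ r : SignType) : ℝ)
        + θ (.b₃ r) := by
  simp only [pre₃, act₂, gate_decide_mul]

lemma normalizedNetwork_eq_gatedNetwork (s₂ : Fin n₂ → SignType) (s₃ : Fin n₃ → SignType)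
    (θ : RealParam n₁ n₂ n₃ → ℝ) (t : ℝ) :
    normalizedNetwork s₂ s₃ θ t
      = gatedNetwork s₂ s₃ θ (act₁ θ t) (act₂ s₂ θ t) (act₃ s₂ s₃ θ t) t := by
  simp only [gatedNetwork, act₃, gate_decide_mul, pre₃_act, pre₂_act]
  simp [normalizedNetwork, network, dotProduct, reluVec, layer_apply]

/-- Directional derivative of `pre₂` in the parameters. -/
def dpre₂ (θ v : RealParam n₁ n₂ n₃ → ℝ) (p₁ : Fin n₁ → Bool) (t : ℝ) (j : Fin n₂) : ℝ :=
  ∑ k, (v (.A₂ j k) * (gate (p₁ k) * (t + θ (.b₁ k))) + θ (.A₂ j k) * (gate (p₁ k) * v (.b₁ k)))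
    + v (.b₂ j)

/-- Directional derivative of `pre₃` in the parameters. -/
def dpre₃ (s₂ : Fin n₂ → SignType) (θ v : RealParam n₁ n₂ n₃ → ℝ)
    (p₁ : Fin n₁ → Bool) (p₂ : Fin n₂ → Bool) (t : ℝ) (r : Fin n₃) : ℝ :=
  ∑ j, (v (.A₃ r j) * (gate (p₂ j) * pre₂ s₂ θ p₁ t j)
    + θ (.A₃ r j) * (gate (p₂ j) * dpre₂ θ v p₁ t j)) + v (.b₃ r)

/-- Directional derivative of `gatedNetwork` in the parameters. -/
def dgatedNetwork (s₂ : Fin n₂ → SignType) (s₃ : Fin n₃ → SignType)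
    (θ v : RealParam n₁ n₂ n₃ → ℝ) (p₁ : Fin n₁ → Bool) (p₂ : Fin n₂ → Bool) (p₃ : Fin n₃ → Bool)
    (t : ℝ) : ℝ :=
  ∑ r, (v (.A₄ r) * (gate (p₃ r) * pre₃ s₂ s₃ θ p₁ p₂ t r)
    + θ (.A₄ r) * (gate (p₃ r) * dpre₃ s₂ θ v p₁ p₂ t r)) + t * v .c₄ + v .b₄

lemma contDiff_gatedNetwork (s₂ : Fin n₂ → SignType) (s₃ : Fin n₃ → SignType)
    (p₁ : Fin n₁ → Bool) (p₂ : Fin n₂ → Bool) (p₃ : Fin n₃ → Bool) (t : ℝ) :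
    ContDiff ℝ 1 fun θ : RealParam n₁ n₂ n₃ → ℝ => gatedNetwork s₂ s₃ θ p₁ p₂ p₃ t := by
  unfold gatedNetwork pre₃ pre₂
  fun_prop

lemma hasDerivAt_line (θ v : RealParam n₁ n₂ n₃ → ℝ) (i : RealParam n₁ n₂ n₃) :
    HasDerivAt (fun x : ℝ => (θ + x • v) i) (v i) 0 := by
  simpa using ((hasDerivAt_id (0 : ℝ)).mul_const (v i)).const_add (θ i)

lemma hasDerivAt_pre₂ (s₂ : Fin n₂ → SignType) (θ v : RealParam n₁ n₂ n₃ → ℝ)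
    (p₁ : Fin n₁ → Bool) (t : ℝ) (j : Fin n₂) :
    HasDerivAt (fun x : ℝ => pre₂ s₂ (θ + x • v) p₁ t j) (dpre₂ θ v p₁ t j) 0 := by
  unfold pre₂ dpre₂
  refine ((HasDerivAt.fun_sum fun k _ => ?_).add_const _).add (hasDerivAt_line θ v _)
  simpa using (hasDerivAt_line θ v (.A₂ j k)).fun_mul
    (((hasDerivAt_line θ v (.b₁ k)).const_add t).const_mul (gate (p₁ k)))

lemma hasDerivAt_pre₃ (s₂ : Fin n₂ → SignType) (s₃ : Fin n₃ → SignType)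
    (θ v : RealParam n₁ n₂ n₃ → ℝ) (p₁ : Fin n₁ → Bool) (p₂ : Fin n₂ → Bool) (t : ℝ)
    (r : Fin n₃) :
    HasDerivAt (fun x : ℝ => pre₃ s₂ s₃ (θ + x • v) p₁ p₂ t r) (dpre₃ s₂ θ v p₁ p₂ t r) 0 := by
  unfold pre₃ dpre₃
  refine ((HasDerivAt.fun_sum fun j _ => ?_).add_const _).add (hasDerivAt_line θ v _)
  simpa using (hasDerivAt_line θ v (.A₃ r j)).fun_mul
    ((hasDerivAt_pre₂ s₂ θ v p₁ t j).const_mul (gate (p₂ j)))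

lemma hasDerivAt_gatedNetwork (s₂ : Fin n₂ → SignType) (s₃ : Fin n₃ → SignType)
    (θ v : RealParam n₁ n₂ n₃ → ℝ) (p₁ : Fin n₁ → Bool) (p₂ : Fin n₂ → Bool) (p₃ : Fin n₃ → Bool)
    (t : ℝ) :
    HasDerivAt (fun x : ℝ => gatedNetwork s₂ s₃ (θ + x • v) p₁ p₂ p₃ t)
      (dgatedNetwork s₂ s₃ θ v p₁ p₂ p₃ t) 0 := by
  unfold gatedNetwork dgatedNetwork
  refine ((HasDerivAt.fun_sum fun r _ => ?_).add
    ((hasDerivAt_line θ v _).const_mul t)).add (hasDerivAt_line θ v _)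
  simpa using (hasDerivAt_line θ v (.A₄ r)).fun_mul
    ((hasDerivAt_pre₃ s₂ s₃ θ v p₁ p₂ t r).const_mul (gate (p₃ r)))

lemma fderiv_gatedNetwork_apply (s₂ : Fin n₂ → SignType) (s₃ : Fin n₃ → SignType)
    (θ v : RealParam n₁ n₂ n₃ → ℝ) (p₁ : Fin n₁ → Bool) (p₂ : Fin n₂ → Bool) (p₃ : Fin n₃ → Bool)
    (t : ℝ) :
    fderiv ℝ (fun θ => gatedNetwork s₂ s₃ θ p₁ p₂ p₃ t) θ v
      = dgatedNetwork s₂ s₃ θ v p₁ p₂ p₃ t := by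
  have h := ((contDiff_gatedNetwork s₂ s₃ p₁ p₂ p₃ t).differentiable one_ne_zero
    θ).hasFDerivAt
  exact (h.hasLineDerivAt v).unique (hasDerivAt_gatedNetwork s₂ s₃ θ v p₁ p₂ p₃ t)

/-! ### Regular inputs and locally constant patterns -/

/-- No neuron is at its kink at the input `t`. -/
def IsRegularInput (s₂ : Fin n₂ → SignType) (s₃ : Fin n₃ → SignType)
    (θ : RealParam n₁ n₂ n₃ → ℝ) (t : ℝ) : Prop :=
  (∀ k, t + θ (.b₁ k) ≠ 0) ∧ (∀ j, pre₂ s₂ θ (act₁ θ t) t j ≠ 0) ∧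
    ∀ r, pre₃ s₂ s₃ θ (act₁ θ t) (act₂ s₂ θ t) t r ≠ 0

lemma ContinuousAt.eventually_decide_pos_eq {X : Type*} [TopologicalSpace X] {f : X → ℝ} {x : X}
    (hf : ContinuousAt f x) (hx : f x ≠ 0) :
    ∀ᶠ y in 𝓝 x, decide (0 < f y) = decide (0 < f x) := by
  rcases hx.lt_or_gt with h | h
  · filter_upwards [hf.eventually (eventually_lt_nhds h)] with y hy
    simp [hy.le.not_gt, h.le.not_gt]
  · filter_upwards [hf.eventually (eventually_gt_nhds h)] with y hy
    simp [hy, h]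

/-- The bits jump only where the preactivations they multiply vanish: gate times preactivation is a
maximum with 0. -/
lemma continuous_pre₂_act (s₂ : Fin n₂ → SignType) (j : Fin n₂) :
    Continuous fun q : (RealParam n₁ n₂ n₃ → ℝ) × ℝ => pre₂ s₂ q.1 (act₁ q.1 q.2) q.2 j := by
  simp only [pre₂_act]
  fun_prop

lemma continuous_pre₃_act (s₂ : Fin n₂ → SignType) (s₃ : Fin n₃ → SignType) (r : Fin n₃) :
    Continuous fun q : (RealParam n₁ n₂ n₃ → ℝ) × ℝ =>
      pre₃ s₂ s₃ q.1 (act₁ q.1 q.2) (act₂ s₂ q.1 q.2) q.2 r := by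
  simp only [pre₃_act]
  have := continuous_pre₂_act (n₁ := n₁) (n₃ := n₃) s₂
  fun_prop

lemma eventually_act₁_eq {θ : RealParam n₁ n₂ n₃ → ℝ} {t : ℝ} {k : Fin n₁}
    (h : t + θ (.b₁ k) ≠ 0) :
    ∀ᶠ q : (RealParam n₁ n₂ n₃ → ℝ) × ℝ in 𝓝 (θ, t), act₁ q.1 q.2 k = act₁ θ t k :=
  ContinuousAt.eventually_decide_pos_eq
    (f := fun q : (RealParam n₁ n₂ n₃ → ℝ) × ℝ => q.2 + q.1 (.b₁ k)) (by fun_prop) h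

lemma eventually_act₂_eq {s₂ : Fin n₂ → SignType} {θ : RealParam n₁ n₂ n₃ → ℝ} {t : ℝ}
    {j : Fin n₂} (h : pre₂ s₂ θ (act₁ θ t) t j ≠ 0) :
    ∀ᶠ q : (RealParam n₁ n₂ n₃ → ℝ) × ℝ in 𝓝 (θ, t), act₂ s₂ q.1 q.2 j = act₂ s₂ θ t j :=
  ContinuousAt.eventually_decide_pos_eq (continuous_pre₂_act s₂ j).continuousAt h

lemma eventually_act₃_eq {s₂ : Fin n₂ → SignType} {s₃ : Fin n₃ → SignType}
    {θ : RealParam n₁ n₂ n₃ → ℝ} {t : ℝ} {r : Fin n₃}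
    (h : pre₃ s₂ s₃ θ (act₁ θ t) (act₂ s₂ θ t) t r ≠ 0) :
    ∀ᶠ q : (RealParam n₁ n₂ n₃ → ℝ) × ℝ in 𝓝 (θ, t), act₃ s₂ s₃ q.1 q.2 r = act₃ s₂ s₃ θ t r :=
  ContinuousAt.eventually_decide_pos_eq (continuous_pre₃_act s₂ s₃ r).continuousAt h

/-- At a regular input no bit changes under small parameter perturbations, so the network agrees
near θ with one polynomial. -/
lemma IsRegularInput.hasStrictFDerivAt {s₂ : Fin n₂ → SignType} {s₃ : Fin n₃ → SignType}
    {θ : RealParam n₁ n₂ n₃ → ℝ} {t : ℝ} (h : IsRegularInput s₂ s₃ θ t) :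
    HasStrictFDerivAt (fun θ' => normalizedNetwork s₂ s₃ θ' t)
      (fderiv ℝ (fun θ' => gatedNetwork s₂ s₃ θ' (act₁ θ t) (act₂ s₂ θ t) (act₃ s₂ s₃ θ t) t) θ)
      θ := by
  refine ((contDiff_gatedNetwork s₂ s₃ _ _ _ t).contDiffAt.hasStrictFDerivAt
    one_ne_zero).congr_of_eventuallyEq ?_
  have hc : Tendsto (fun θ' : RealParam n₁ n₂ n₃ → ℝ => (θ', t)) (𝓝 θ) (𝓝 (θ, t)) :=
    Continuous.tendsto (by fun_prop) θ
  filter_upwards [hc.eventually (eventually_all.2 fun k => eventually_act₁_eq (h.1 k)),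
    hc.eventually (eventually_all.2 fun j => eventually_act₂_eq (h.2.1 j)),
    hc.eventually (eventually_all.2 fun r => eventually_act₃_eq (h.2.2 r))] with θ' h₁ h₂ h₃
  rw [normalizedNetwork_eq_gatedNetwork, funext h₁, funext h₂, funext h₃]

/-! ### Local inversion against null sets -/

/-- If linear functionals on a finite-dimensional space separate points, then
finitely many of them do. -/
lemma exists_finset_separating {E ι : Type*} [AddCommGroup E] [Module ℝ E] [FiniteDimensional ℝ E]
    (D : ι → E →ₗ[ℝ] ℝ) (hD : ∀ v, (∀ i, D i v = 0) → v = 0) :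
    ∃ T : Finset ι, ∀ v, (∀ i ∈ T, D i v = 0) → v = 0 := by
  classical
  -- A minimal finite intersection of kernels: a functional not vanishing on it would cut it down
  -- further.
  obtain ⟨_, ⟨T, rfl⟩, hT⟩ := (wellFounded_lt (α := Submodule ℝ E)).has_min
    (Set.range fun T : Finset ι => ⨅ i ∈ T, (D i).ker) ⟨_, ∅, rfl⟩
  refine ⟨T, fun v hv => hD v fun i => by_contra fun hi => ?_⟩
  refine hT _ ⟨insert i T, rfl⟩ (lt_of_le_of_ne
    (le_iInf₂ fun j hj => iInf₂_le j (Finset.mem_insert_of_mem hj)) fun heq => ?_)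
  have hmem : v ∈ ⨅ i ∈ T, (D i).ker := by simpa [Submodule.mem_iInf] using hv
  have : v ∈ ⨅ j ∈ insert i T, (D j).ker := by
    dsimp only at heq
    rwa [heq]
  simp only [Submodule.mem_iInf, LinearMap.mem_ker] at this
  exact hi (this i (Finset.mem_insert_self _ _))

/-- If the network is infinitesimally identifiable at one parameter vector, then fixing a real
parameter loses functions. -/
theorem exists_notMem_of_fixed_param {s₂ : Fin n₂ → SignType} {s₃ : Fin n₃ → SignType}
    {θ : RealParam n₁ n₂ n₃ → ℝ}
    (hθ : ∀ v, (∀ t, IsRegularInput s₂ s₃ θ t →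
      dgatedNetwork s₂ s₃ θ v (act₁ θ t) (act₂ s₂ θ t) (act₃ s₂ s₃ θ t) t = 0) → v = 0)
    (i : RealParam n₁ n₂ n₃) (c : ℝ) :
    ∃ θ₀ : RealParam n₁ n₂ n₃ → ℝ, ∀ σ₂ σ₃ θ', θ' i = c →
      normalizedNetwork s₂ s₃ θ₀ ≠ normalizedNetwork σ₂ σ₃ θ' := by
  classical
  by_contra! hcon
  let E := RealParam n₁ n₂ n₃ → ℝ
  let D : {t // IsRegularInput s₂ s₃ θ t} → E →L[ℝ] ℝ := fun t => fderiv ℝ (fun θ' =>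
    gatedNetwork s₂ s₃ θ' (act₁ θ t.1) (act₂ s₂ θ t.1) (act₃ s₂ s₃ θ t.1) t.1) θ
  obtain ⟨T, hT⟩ := exists_finset_separating (fun t => (D t).toLinearMap) fun v hv =>
    hθ v fun t ht => by
      rw [← fderiv_gatedNetwork_apply]
      exact hv ⟨t, ht⟩
  let F : E →L[ℝ] (T → ℝ) := ContinuousLinearMap.pi fun t => D t.1
  obtain ⟨G, hG⟩ := F.toLinearMap.exists_leftInverse_of_injective
    ((Submodule.eq_bot_iff _).2 fun v hv => hT v fun t ht => congrFun hv ⟨t, ht⟩)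
  let Λ : (T → ℝ) →L[ℝ] E := LinearMap.toContinuousLinearMap G
  let Φ : (ℝ → ℝ) → E := fun f => Λ fun t => f t.1.1
  have hΦ : HasStrictFDerivAt (fun θ' => Φ (normalizedNetwork s₂ s₃ θ'))
      ((ContinuousLinearEquiv.refl ℝ E : E ≃L[ℝ] E) : E →L[ℝ] E) θ := by
    have h1 : HasStrictFDerivAt (fun θ' => fun t : T => normalizedNetwork s₂ s₃ θ' t.1.1) F θ :=
      hasStrictFDerivAt_pi.2 fun t => t.1.2.hasStrictFDerivAt
    have h2 := Λ.hasStrictFDerivAt.comp θ h1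
    have h3 : Λ.comp F = ((ContinuousLinearEquiv.refl ℝ E : E ≃L[ℝ] E) : E →L[ℝ] E) :=
      ContinuousLinearMap.ext fun v => LinearMap.congr_fun hG v
    rw [h3] at h2
    exact h2
  -- Inverse function theorem: the derivative at θ is the identity.
  have hnhds : Set.range (fun θ' : E => Φ (normalizedNetwork s₂ s₃ θ')) ∈
      𝓝 (Φ (normalizedNetwork s₂ s₃ θ)) := by
    rw [← hΦ.map_nhds_eq_of_equiv]
    exact mem_map.2 (univ_mem' fun θ' => ⟨θ', rfl⟩)
  -- `T` is finite, so only finitely many sign vectors and patterns occur.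
  let P := (T → Fin n₁ → Bool) × (T → Fin n₂ → Bool) × (T → Fin n₃ → Bool)
  let Ψ : (Fin n₂ → SignType) × (Fin n₃ → SignType) × P → E → E := fun p θ' =>
    Λ fun t => gatedNetwork p.1 p.2.1 θ' (p.2.2.1 t) (p.2.2.2.1 t) (p.2.2.2.2 t) t.1.1
  have hsub : Set.range (fun θ' : E => Φ (normalizedNetwork s₂ s₃ θ')) ⊆
      ⋃ p, Ψ p '' {θ' | θ' i = c} := by
    rintro _ ⟨θ₀, rfl⟩
    obtain ⟨σ₂, σ₃, θ', hi, h⟩ := hcon θ₀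
    refine Set.mem_iUnion.2 ⟨(σ₂, σ₃, fun t => act₁ θ' t.1.1, fun t => act₂ σ₂ θ' t.1.1,
      fun t => act₃ σ₂ σ₃ θ' t.1.1), θ', hi, ?_⟩
    simp only [Ψ, Φ, h, normalizedNetwork_eq_gatedNetwork]
  have hnull : volume (⋃ p, Ψ p '' {θ' | θ' i = c}) = 0 := by
    refine measure_iUnion_null fun p => ?_
    -- A differentiable self-map of a finite-dimensional space sends null sets, here a hyperplane,
    -- to null sets.
    refine addHaar_image_eq_zero_of_differentiableOn_of_addHaar_eq_zero _
      (Differentiable.differentiableOn ?_) ?_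
    · exact Λ.differentiable.comp (differentiable_pi.2 fun t =>
        (contDiff_gatedNetwork _ _ _ _ _ _).differentiable one_ne_zero)
    · rw [volume_pi]
      exact Measure.pi_hyperplane (α := fun _ => ℝ) (fun _ => volume) i c
  exact (Measure.measure_pos_of_mem_nhds volume hnhds).ne' (measure_mono_null hsub hnull)

theorem restrictedModel_ssubset {s₂ : Fin n₂ → SignType} {s₃ : Fin n₃ → SignType}
    {θ : RealParam n₁ n₂ n₃ → ℝ}
    (hθ : ∀ v, (∀ t, IsRegularInput s₂ s₃ θ t →
      dgatedNetwork s₂ s₃ θ v (act₁ θ t) (act₂ s₂ θ t) (act₃ s₂ s₃ θ t) t = 0) → v = 0)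
    {S : Set (RealParam n₁ n₂ n₃)} (hS : S.Nonempty) (v : S → ℝ) :
    restrictedModel S v ⊂ reluModel n₁ n₂ n₃ := by
  obtain ⟨i, hi⟩ := hS
  refine ⟨?_, fun hsub => ?_⟩
  · rintro _ ⟨σ₂, σ₃, θ', -, rfl⟩
    exact normalizedNetwork_mem_reluModel σ₂ σ₃ θ'
  · obtain ⟨θ₀, h₀⟩ := exists_notMem_of_fixed_param hθ i (v ⟨i, hi⟩)
    obtain ⟨σ₂, σ₃, θ', hv, h⟩ := hsub (normalizedNetwork_mem_reluModel s₂ s₃ θ₀)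
    exact h₀ σ₂ σ₃ θ' (hv ⟨i, hi⟩) h

end Gated

/-! ### Affine pieces and isolated kinks -/

section Switch

variable {n₁ n₂ n₃ : ℕ}

/-- Functions `t ↦ a t + b`. -/
def IsAffineFun (f : ℝ → ℝ) : Prop := ∃ a b : ℝ, ∀ t, f t = a * t + b

namespace IsAffineFun

lemma const (c : ℝ) : IsAffineFun fun _ => c := ⟨0, c, fun t => by ring⟩

lemma id : IsAffineFun fun t => t := ⟨1, 0, fun t => by ring⟩

lemma add {f g : ℝ → ℝ} (hf : IsAffineFun f) (hg : IsAffineFun g) :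
    IsAffineFun fun t => f t + g t := by
  obtain ⟨a, b, h⟩ := hf
  obtain ⟨a', b', h'⟩ := hg
  exact ⟨a + a', b + b', fun t => by simp only [h, h']; ring⟩

lemma const_mul {f : ℝ → ℝ} (c : ℝ) (hf : IsAffineFun f) : IsAffineFun fun t => c * f t := by
  obtain ⟨a, b, h⟩ := hf
  exact ⟨c * a, c * b, fun t => by simp only [h]; ring⟩

lemma mul_const {f : ℝ → ℝ} (hf : IsAffineFun f) (c : ℝ) : IsAffineFun fun t => f t * c := by
  simpa only [mul_comm] using hf.const_mul c

lemma sum {ι : Type*} {s : Finset ι} {f : ι → ℝ → ℝ} (h : ∀ i, IsAffineFun (f i)) :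
    IsAffineFun fun t => ∑ i ∈ s, f i t := by
  choose a b h using h
  refine ⟨∑ i ∈ s, a i, ∑ i ∈ s, b i, fun t => ?_⟩
  simp only [h, Finset.sum_add_distrib, Finset.sum_mul]

/-- An affine function that vanishes on one side of a point vanishes. -/
lemma eq_zero {f : ℝ → ℝ} (hf : IsAffineFun f) {x c : ℝ} (hc : c ≠ 0)
    (h : ∀ᶠ t in 𝓝 x, 0 < c * (t - x) → f t = 0) (t : ℝ) : f t = 0 := by
  obtain ⟨a, b, hab⟩ := hf
  -- The points x + c * e with e > 0 lie on the required side, since c * (c * e) > 0; two of them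
  -- determine the affine function.
  have hline : Tendsto (fun e : ℝ => x + c * e) (𝓝 0) (𝓝 x) :=
    Continuous.tendsto' (by fun_prop) _ _ (by simp)
  obtain ⟨δ, hδ, hball⟩ := Metric.eventually_nhds_iff.1 (hline.eventually h)
  have key : ∀ e, 0 < e → e < δ → a * (x + c * e) + b = 0 := fun e he he' => by
    rw [← hab]
    refine hball (by simpa [abs_of_pos he] using he') ?_
    have : c * (x + c * e - x) = c ^ 2 * e := by ring
    rw [this]
    positivity
  have h1 := key (δ / 2) (by linarith) (by linarith)
  have h2 := key (δ / 4) (by linarith) (by linarith)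
  have ha : a = 0 := by
    have h3 : a * (c * (δ / 4)) = 0 := by linear_combination h1 - h2
    have h4 : c * (δ / 4) ≠ 0 := mul_ne_zero hc (by linarith)
    exact (mul_eq_zero.1 h3).resolve_right h4
  rw [hab, ha]
  rw [ha] at h1
  linarith

end IsAffineFun

lemma isAffineFun_pre₂ (s₂ : Fin n₂ → SignType) (θ : RealParam n₁ n₂ n₃ → ℝ)
    (p₁ : Fin n₁ → Bool) (j : Fin n₂) : IsAffineFun fun t => pre₂ s₂ θ p₁ t j :=
  ((IsAffineFun.sum fun _ => ((IsAffineFun.id.add (.const _)).const_mul _).const_mul _).add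
    (IsAffineFun.id.mul_const _)).add (.const _)

lemma isAffineFun_dpre₂ (θ v : RealParam n₁ n₂ n₃ → ℝ)
    (p₁ : Fin n₁ → Bool) (j : Fin n₂) : IsAffineFun fun t => dpre₂ θ v p₁ t j :=
  (IsAffineFun.sum fun _ => (((IsAffineFun.id.add (.const _)).const_mul _).const_mul _).add
    (.const _)).add (.const _)

lemma isAffineFun_pre₃ (s₂ : Fin n₂ → SignType) (s₃ : Fin n₃ → SignType)
    (θ : RealParam n₁ n₂ n₃ → ℝ) (p₁ : Fin n₁ → Bool) (p₂ : Fin n₂ → Bool) (r : Fin n₃) :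
    IsAffineFun fun t => pre₃ s₂ s₃ θ p₁ p₂ t r :=
  ((IsAffineFun.sum fun j => ((isAffineFun_pre₂ s₂ θ p₁ j).const_mul _).const_mul _).add
    (IsAffineFun.id.mul_const _)).add (.const _)

lemma isAffineFun_dpre₃ (s₂ : Fin n₂ → SignType) (θ v : RealParam n₁ n₂ n₃ → ℝ)
    (p₁ : Fin n₁ → Bool) (p₂ : Fin n₂ → Bool) (r : Fin n₃) :
    IsAffineFun fun t => dpre₃ s₂ θ v p₁ p₂ t r :=
  (IsAffineFun.sum fun j => (((isAffineFun_pre₂ s₂ θ p₁ j).const_mul _).const_mul _).add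
    (((isAffineFun_dpre₂ θ v p₁ j).const_mul _).const_mul _)).add (.const _)

lemma isAffineFun_dgatedNetwork (s₂ : Fin n₂ → SignType) (s₃ : Fin n₃ → SignType)
    (θ v : RealParam n₁ n₂ n₃ → ℝ) (p₁ : Fin n₁ → Bool) (p₂ : Fin n₂ → Bool)
    (p₃ : Fin n₃ → Bool) : IsAffineFun fun t => dgatedNetwork s₂ s₃ θ v p₁ p₂ p₃ t :=
  ((IsAffineFun.sum fun r => (((isAffineFun_pre₃ s₂ s₃ θ p₁ p₂ r).const_mul _).const_mul _).add
    (((isAffineFun_dpre₃ s₂ θ v p₁ p₂ r).const_mul _).const_mul _)).add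
    (IsAffineFun.id.mul_const _)).add (.const _)

/-- Effect on a sum of switching one activation bit on. -/
lemma sum_switch {n : ℕ} {p q : Fin n → Bool} {i : Fin n} (hpq : ∀ k, k ≠ i → p k = q k)
    (hp : p i = true) (hq : q i = false) (G : Fin n → Bool → ℝ) :
    ∑ k, G k (p k) = ∑ k, G k (q k) + (G i true - G i false) := by
  rw [← sub_eq_iff_eq_add', ← Finset.sum_sub_distrib, Finset.sum_eq_single i, hp, hq]
  · intro k _ hk
    rw [hpq k hk, sub_self]
  · simp

lemma pre₂_switch {p q : Fin n₁ → Bool} {k : Fin n₁} (hpq : ∀ i, i ≠ k → p i = q i)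
    (hp : p k = true) (hq : q k = false) (s₂ : Fin n₂ → SignType) (θ : RealParam n₁ n₂ n₃ → ℝ)
    (t : ℝ) (j : Fin n₂) :
    pre₂ s₂ θ p t j = pre₂ s₂ θ q t j + θ (.A₂ j k) * (t + θ (.b₁ k)) := by
  unfold pre₂
  rw [sum_switch hpq hp hq fun k b => θ (.A₂ j k) * (gate b * (t + θ (.b₁ k)))]
  simp only [gate_true, gate_false]
  ring

lemma dpre₂_switch {p q : Fin n₁ → Bool} {k : Fin n₁} (hpq : ∀ i, i ≠ k → p i = q i)
    (hp : p k = true) (hq : q k = false) (θ v : RealParam n₁ n₂ n₃ → ℝ)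
    (t : ℝ) (j : Fin n₂) :
    dpre₂ θ v p t j = dpre₂ θ v q t j
      + (v (.A₂ j k) * (t + θ (.b₁ k)) + θ (.A₂ j k) * v (.b₁ k)) := by
  unfold dpre₂
  rw [sum_switch hpq hp hq fun k b =>
    v (.A₂ j k) * (gate b * (t + θ (.b₁ k))) + θ (.A₂ j k) * (gate b * v (.b₁ k))]
  simp only [gate_true, gate_false]
  ring

lemma pre₃_switch {p q : Fin n₂ → Bool} {j : Fin n₂} (hpq : ∀ i, i ≠ j → p i = q i)
    (hp : p j = true) (hq : q j = false) (s₂ : Fin n₂ → SignType) (s₃ : Fin n₃ → SignType)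
    (θ : RealParam n₁ n₂ n₃ → ℝ) (p₁ : Fin n₁ → Bool) (t : ℝ) (r : Fin n₃) :
    pre₃ s₂ s₃ θ p₁ p t r = pre₃ s₂ s₃ θ p₁ q t r + θ (.A₃ r j) * pre₂ s₂ θ p₁ t j := by
  unfold pre₃
  rw [sum_switch hpq hp hq fun j b => θ (.A₃ r j) * (gate b * pre₂ s₂ θ p₁ t j)]
  simp only [gate_true, gate_false]
  ring

lemma dpre₃_switch {p q : Fin n₂ → Bool} {j : Fin n₂} (hpq : ∀ i, i ≠ j → p i = q i)
    (hp : p j = true) (hq : q j = false) (s₂ : Fin n₂ → SignType)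
    (θ v : RealParam n₁ n₂ n₃ → ℝ) (p₁ : Fin n₁ → Bool) (t : ℝ) (r : Fin n₃) :
    dpre₃ s₂ θ v p₁ p t r = dpre₃ s₂ θ v p₁ q t r
      + (v (.A₃ r j) * pre₂ s₂ θ p₁ t j + θ (.A₃ r j) * dpre₂ θ v p₁ t j) := by
  unfold dpre₃
  rw [sum_switch hpq hp hq fun j b =>
    v (.A₃ r j) * (gate b * pre₂ s₂ θ p₁ t j) + θ (.A₃ r j) * (gate b * dpre₂ θ v p₁ t j)]
  simp only [gate_true, gate_false]
  ring

/-- At a kink of exactly one neuron, of the second layer, the derivative vanishes identically for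
both activation patterns next to the kink. -/
lemma dgatedNetwork_eq_zero_of_kink₂ {s₂ : Fin n₂ → SignType} {s₃ : Fin n₃ → SignType}
    {θ v : RealParam n₁ n₂ n₃ → ℝ}
    (hv : ∀ t, IsRegularInput s₂ s₃ θ t →
      dgatedNetwork s₂ s₃ θ v (act₁ θ t) (act₂ s₂ θ t) (act₃ s₂ s₃ θ t) t = 0)
    {x a : ℝ} {j : Fin n₂} (ha : a ≠ 0) (h₁ : ∀ k, x + θ (.b₁ k) ≠ 0)
    (hj : ∀ t, pre₂ s₂ θ (act₁ θ x) t j = a * (t - x))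
    (h₂ : ∀ i, i ≠ j → pre₂ s₂ θ (act₁ θ x) x i ≠ 0)
    (h₃ : ∀ r, pre₃ s₂ s₃ θ (act₁ θ x) (act₂ s₂ θ x) x r ≠ 0) (b : Bool) (t : ℝ) :
    dgatedNetwork s₂ s₃ θ v (act₁ θ x) (Function.update (act₂ s₂ θ x) j b) (act₃ s₂ s₃ θ x) t
      = 0 := by
  have hc : Tendsto (fun t : ℝ => (θ, t)) (𝓝 x) (𝓝 (θ, x)) :=
    Continuous.tendsto (by fun_prop) x
  have e₁ := hc.eventually (eventually_all.2 fun k => eventually_act₁_eq (h₁ k))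
  have e₂ := hc.eventually (eventually_all.2 fun i => eventually_imp_distrib_left.2 fun hi : i ≠ j =>
    eventually_act₂_eq (h₂ i hi))
  have e₃ := hc.eventually (eventually_all.2 fun r => eventually_act₃_eq (h₃ r))
  have f₁ : ∀ᶠ t in 𝓝 x, ∀ k, t + θ (.b₁ k) ≠ 0 := eventually_all.2 fun k =>
    ContinuousAt.eventually_ne (by fun_prop) (h₁ k)
  have f₂ := hc.eventually (eventually_all.2 fun i => eventually_imp_distrib_left.2 fun hi : i ≠ j =>
    (continuous_pre₂_act s₂ i).continuousAt.eventually_ne (h₂ i hi))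
  have f₃ := hc.eventually (eventually_all.2 fun r =>
    (continuous_pre₃_act s₂ s₃ r).continuousAt.eventually_ne (h₃ r))
  have key : ∀ᶠ t in 𝓝 x, a * (t - x) ≠ 0 → dgatedNetwork s₂ s₃ θ v (act₁ θ x)
      (Function.update (act₂ s₂ θ x) j (decide (0 < a * (t - x)))) (act₃ s₂ s₃ θ x) t = 0 := by
    filter_upwards [e₁, e₂, e₃, f₁, f₂, f₃] with t e₁ e₂ e₃ f₁ f₂ f₃ ht
    have e₁' : act₁ θ t = act₁ θ x := funext e₁
    have e₂' : act₂ s₂ θ t = Function.update (act₂ s₂ θ x) j (decide (0 < a * (t - x))) := by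
      ext1 i
      rcases eq_or_ne i j with rfl | hi
      · rw [Function.update_self, act₂, e₁', hj]
      · rw [Function.update_of_ne hi, e₂ i hi]
    have := hv t ⟨f₁, fun i => ?_, f₃⟩
    · rwa [e₁', e₂', funext e₃] at this
    · rcases eq_or_ne i j with rfl | hi
      · rwa [e₁', hj]
      · exact f₂ i hi
  cases b
  · refine (isAffineFun_dgatedNetwork _ _ _ _ _ _ _).eq_zero (x := x) (neg_ne_zero.2 ha) ?_ t
    filter_upwards [key] with t ht h
    have h' : a * (t - x) < 0 := by linarith
    simpa [h'.le.not_gt] using ht h'.ne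
  · refine (isAffineFun_dgatedNetwork _ _ _ _ _ _ _).eq_zero (x := x) ha ?_ t
    filter_upwards [key] with t ht h
    simpa [h] using ht h.ne'

/-- The relation between derivatives that a kink of one neuron of the second layer imposes. -/
lemma kink₂_relation {s₂ : Fin n₂ → SignType} {s₃ : Fin n₃ → SignType}
    {θ v : RealParam n₁ n₂ n₃ → ℝ}
    (hv : ∀ t, IsRegularInput s₂ s₃ θ t →
      dgatedNetwork s₂ s₃ θ v (act₁ θ t) (act₂ s₂ θ t) (act₃ s₂ s₃ θ t) t = 0)
    {x a : ℝ} {j : Fin n₂} (ha : a ≠ 0) (h₁ : ∀ k, x + θ (.b₁ k) ≠ 0)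
    (hj : ∀ t, pre₂ s₂ θ (act₁ θ x) t j = a * (t - x))
    (h₂ : ∀ i, i ≠ j → pre₂ s₂ θ (act₁ θ x) x i ≠ 0)
    (h₃ : ∀ r, pre₃ s₂ s₃ θ (act₁ θ x) (act₂ s₂ θ x) x r ≠ 0) (t : ℝ) :
    (∑ r, gate (act₃ s₂ s₃ θ x r) * (v (.A₄ r) * θ (.A₃ r j) + θ (.A₄ r) * v (.A₃ r j)))
        * (a * (t - x))
      + (∑ r, gate (act₃ s₂ s₃ θ x r) * (θ (.A₄ r) * θ (.A₃ r j))) * dpre₂ θ v (act₁ θ x) t j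
      = 0 := by
  have ht := dgatedNetwork_eq_zero_of_kink₂ hv ha h₁ hj h₂ h₃ true t
  have hf := dgatedNetwork_eq_zero_of_kink₂ hv ha h₁ hj h₂ h₃ false t
  have hpq : ∀ i, i ≠ j → Function.update (act₂ s₂ θ x) j true i
      = Function.update (act₂ s₂ θ x) j false i := fun i hi => by
    rw [Function.update_of_ne hi, Function.update_of_ne hi]
  -- In the difference of the two patterns only the contribution of neuron `j` survives.
  rw [← sub_eq_zero.2 (ht.trans hf.symm)]
  simp only [dgatedNetwork, pre₃_switch hpq (Function.update_self ..) (Function.update_self ..),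
    dpre₃_switch hpq (Function.update_self ..) (Function.update_self ..), add_sub_add_right_eq_sub,
    ← Finset.sum_sub_distrib, Finset.sum_mul, ← Finset.sum_add_distrib, hj]
  exact Finset.sum_congr rfl fun r _ => by ring

/-- At a kink of exactly one neuron, of the third layer, the derivative vanishes identically for
both activation patterns next to the kink. -/
lemma dgatedNetwork_eq_zero_of_kink₃ {s₂ : Fin n₂ → SignType} {s₃ : Fin n₃ → SignType}
    {θ v : RealParam n₁ n₂ n₃ → ℝ}
    (hv : ∀ t, IsRegularInput s₂ s₃ θ t →
      dgatedNetwork s₂ s₃ θ v (act₁ θ t) (act₂ s₂ θ t) (act₃ s₂ s₃ θ t) t = 0)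
    {x a : ℝ} {r : Fin n₃} (ha : a ≠ 0) (h₁ : ∀ k, x + θ (.b₁ k) ≠ 0)
    (h₂ : ∀ j, pre₂ s₂ θ (act₁ θ x) x j ≠ 0)
    (hr : ∀ t, pre₃ s₂ s₃ θ (act₁ θ x) (act₂ s₂ θ x) t r = a * (t - x))
    (h₃ : ∀ i, i ≠ r → pre₃ s₂ s₃ θ (act₁ θ x) (act₂ s₂ θ x) x i ≠ 0) (b : Bool) (t : ℝ) :
    dgatedNetwork s₂ s₃ θ v (act₁ θ x) (act₂ s₂ θ x) (Function.update (act₃ s₂ s₃ θ x) r b) t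
      = 0 := by
  have hc : Tendsto (fun t : ℝ => (θ, t)) (𝓝 x) (𝓝 (θ, x)) :=
    Continuous.tendsto (by fun_prop) x
  have e₁ := hc.eventually (eventually_all.2 fun k => eventually_act₁_eq (h₁ k))
  have e₂ := hc.eventually (eventually_all.2 fun j => eventually_act₂_eq (h₂ j))
  have e₃ := hc.eventually (eventually_all.2 fun i => eventually_imp_distrib_left.2 fun hi : i ≠ r =>
    eventually_act₃_eq (h₃ i hi))
  have f₁ : ∀ᶠ t in 𝓝 x, ∀ k, t + θ (.b₁ k) ≠ 0 := eventually_all.2 fun k =>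
    ContinuousAt.eventually_ne (by fun_prop) (h₁ k)
  have f₂ := hc.eventually (eventually_all.2 fun j =>
    (continuous_pre₂_act s₂ j).continuousAt.eventually_ne (h₂ j))
  have f₃ := hc.eventually (eventually_all.2 fun i => eventually_imp_distrib_left.2 fun hi : i ≠ r =>
    (continuous_pre₃_act s₂ s₃ i).continuousAt.eventually_ne (h₃ i hi))
  have key : ∀ᶠ t in 𝓝 x, a * (t - x) ≠ 0 → dgatedNetwork s₂ s₃ θ v (act₁ θ x) (act₂ s₂ θ x)
      (Function.update (act₃ s₂ s₃ θ x) r (decide (0 < a * (t - x)))) t = 0 := by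
    filter_upwards [e₁, e₂, e₃, f₁, f₂, f₃] with t e₁ e₂ e₃ f₁ f₂ f₃ ht
    have e₁' : act₁ θ t = act₁ θ x := funext e₁
    have e₂' : act₂ s₂ θ t = act₂ s₂ θ x := funext e₂
    have e₃' : act₃ s₂ s₃ θ t
        = Function.update (act₃ s₂ s₃ θ x) r (decide (0 < a * (t - x))) := by
      ext1 i
      rcases eq_or_ne i r with rfl | hi
      · rw [Function.update_self, act₃, e₁', e₂', hr]
      · rw [Function.update_of_ne hi, e₃ i hi]
    have := hv t ⟨f₁, f₂, fun i => ?_⟩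
    · rwa [e₁', e₂', e₃'] at this
    · rcases eq_or_ne i r with rfl | hi
      · rwa [e₁', e₂', hr]
      · exact f₃ i hi
  cases b
  · refine (isAffineFun_dgatedNetwork _ _ _ _ _ _ _).eq_zero (x := x) (neg_ne_zero.2 ha) ?_ t
    filter_upwards [key] with t ht h
    have h' : a * (t - x) < 0 := by linarith
    simpa [h'.le.not_gt] using ht h'.ne
  · refine (isAffineFun_dgatedNetwork _ _ _ _ _ _ _).eq_zero (x := x) ha ?_ t
    filter_upwards [key] with t ht h
    simpa [h] using ht h.ne'

/-- The relation between derivatives that a kink of one neuron of the third layer imposes. -/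
lemma kink₃_relation {s₂ : Fin n₂ → SignType} {s₃ : Fin n₃ → SignType}
    {θ v : RealParam n₁ n₂ n₃ → ℝ}
    (hv : ∀ t, IsRegularInput s₂ s₃ θ t →
      dgatedNetwork s₂ s₃ θ v (act₁ θ t) (act₂ s₂ θ t) (act₃ s₂ s₃ θ t) t = 0)
    {x a : ℝ} {r : Fin n₃} (ha : a ≠ 0) (h₁ : ∀ k, x + θ (.b₁ k) ≠ 0)
    (h₂ : ∀ j, pre₂ s₂ θ (act₁ θ x) x j ≠ 0)
    (hr : ∀ t, pre₃ s₂ s₃ θ (act₁ θ x) (act₂ s₂ θ x) t r = a * (t - x))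
    (h₃ : ∀ i, i ≠ r → pre₃ s₂ s₃ θ (act₁ θ x) (act₂ s₂ θ x) x i ≠ 0) (t : ℝ) :
    v (.A₄ r) * (a * (t - x)) + θ (.A₄ r) * dpre₃ s₂ θ v (act₁ θ x) (act₂ s₂ θ x) t r = 0 := by
  have ht := dgatedNetwork_eq_zero_of_kink₃ hv ha h₁ h₂ hr h₃ true t
  have hf := dgatedNetwork_eq_zero_of_kink₃ hv ha h₁ h₂ hr h₃ false t
  have hpq : ∀ i, i ≠ r → Function.update (act₃ s₂ s₃ θ x) r true i
      = Function.update (act₃ s₂ s₃ θ x) r false i := fun i hi => by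
    rw [Function.update_of_ne hi, Function.update_of_ne hi]
  unfold dgatedNetwork at ht hf
  rw [sum_switch hpq (Function.update_self ..) (Function.update_self ..) fun r b =>
    v (.A₄ r) * (gate b * pre₃ s₂ s₃ θ (act₁ θ x) (act₂ s₂ θ x) t r)
      + θ (.A₄ r) * (gate b * dpre₃ s₂ θ v (act₁ θ x) (act₂ s₂ θ x) t r)] at ht
  simp only [gate_true, gate_false, hr] at ht hf
  linear_combination ht - hf

end Switch

/-! ### The zigzag witness and the kinks of its second layer -/

section Witness

/-- The pattern in which exactly the first `m` neurons are active. -/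
def initialPattern {n : ℕ} (m : ℕ) (k : Fin n) : Bool := decide (k.1 < m)

lemma initialPattern_zero {n : ℕ} (k : Fin n) : initialPattern 0 k = false := by
  simp [initialPattern]

lemma initialPattern_succ_of_ne {n : ℕ} (m : Fin n) (k : Fin n) (hk : k ≠ m) :
    initialPattern (m + 1) k = initialPattern m k := by
  have : k.1 ≠ m.1 := fun h => hk (Fin.ext h)
  simp only [initialPattern, decide_eq_decide]
  omega

lemma initialPattern_succ_self {n : ℕ} (m : Fin n) : initialPattern (m + 1) m = true := by
  simp [initialPattern]

lemma initialPattern_self {n : ℕ} (m : Fin n) : initialPattern m m = false := by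
  simp [initialPattern]

lemma neg_one_pow_cases (m : ℕ) : (-1 : ℝ) ^ m = 1 ∨ (-1 : ℝ) ^ m = -1 := neg_one_pow_eq_or ℝ m

variable (n₁ n₂ n₃ : ℕ)

/-- Distance between the kinks of the first layer of the witness. -/
def spacing : ℝ := n₂ + 1

/-- Depth of the negative teeth of the third layer of the witness. -/
def depth : ℝ := (n₁ + 2) * spacing n₂

/-- The `j`-th level whose crossing switches the `j`-th neuron of the second layer. -/
def knot (j : ℕ) : ℝ := j - n₂

/-- Value of the `r`-th neuron of the third layer at even knots. -/
def hiLevel (r : ℕ) : ℝ := r + 2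

/-- Value of the `r`-th neuron of the third layer at odd knots. -/
def loLevel (r : ℕ) : ℝ := if r = 0 then 1 else -depth n₁ n₂

/-- Parameters at which the network is infinitesimally identifiable: all neurons of the second layer
are translates of one zigzag function `φ`, and those of the third layer are zigzag functions
of `φ`. -/
def witness : RealParam n₁ n₂ n₃ → ℝ
  | .b₁ k => -(k * spacing n₂)
  -- Starting from slope 1, each first-layer kink reverses the slope of the zigzag.
  | .A₂ _ k => -2 * (-1) ^ k.1
  | .b₂ j => -knot n₂ j
  -- The extra -1 cancels the source slope, so that on the negative axis, where φ(t) = t, the first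
  -- tooth has slope lo - hi; later entries reverse it.
  | .A₃ r j => if j.1 = 0 then loLevel n₁ n₂ r - hiLevel r - 1
      else 2 * (-1) ^ j.1 * (loLevel n₁ n₂ r - hiLevel r)
  | .b₃ r => hiLevel r + n₂
  | .A₄ _ => 1
  | .c₄ => 0
  | .b₄ => 0

/-- The `i`-th input at which the zigzag function crosses the `j`-th knot. -/
noncomputable def crossing (i j : ℕ) : ℝ :=
  i * spacing n₂ + (-1) ^ i * knot n₂ j - (1 - (-1) ^ i) / 2 * spacing n₂

variable {n₁ n₂ n₃}

lemma hiLevel_pos (r : ℕ) : 0 < hiLevel r := by unfold hiLevel; positivity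

lemma depth_pos : 0 < depth n₁ n₂ := by unfold depth spacing; positivity

lemma loLevel_lt_hiLevel (r : ℕ) : loLevel n₁ n₂ r < hiLevel r := by
  have := depth_pos (n₁ := n₁) (n₂ := n₂)
  have := hiLevel_pos r
  unfold loLevel
  split_ifs with h
  · simp [hiLevel, h]
  · linarith

/-- All knots lie strictly between `-spacing` and 0, the extreme values of the zigzag, so every
segment crosses every knot in its interior. -/
lemma crossing_bounds (i : ℕ) {j : ℕ} (hj : j < n₂) :
    (i - 1) * spacing n₂ < crossing n₂ i j ∧ crossing n₂ i j < i * spacing n₂ := by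
  have h1 : knot n₂ j ≤ -1 := by
    have : (j : ℝ) + 1 ≤ n₂ := by exact_mod_cast hj
    unfold knot; linarith
  have h2 : -spacing n₂ < knot n₂ j := by
    have : (0 : ℝ) ≤ j := j.cast_nonneg
    unfold knot spacing; linarith
  unfold crossing
  rcases neg_one_pow_cases i with h | h <;> rw [h] <;> constructor <;> linarith

lemma knot_le_crossing (i : ℕ) {j : ℕ} (hj : j < n₂) : knot n₂ j ≤ crossing n₂ i j := by
  have h1 : knot n₂ j < 0 := by
    have : (j : ℝ) < n₂ := by exact_mod_cast hj
    unfold knot; linarith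
  rcases i with _ | i
  · simp [crossing]
  · have h2 := (crossing_bounds (i + 1) hj).1
    have h3 : 0 ≤ ((i + 1 : ℕ) - 1 : ℝ) * spacing n₂ := by
      push_cast
      unfold spacing
      rw [add_sub_cancel_right]
      positivity
    linarith

lemma add_witness_b₁_eq (x : ℝ) (k : Fin n₁) :
    x + witness n₁ n₂ n₃ (.b₁ k) = x - k * spacing n₂ := by
  simp [witness, sub_eq_add_neg]

lemma add_witness_b₁_lt {x : ℝ} {i : ℕ} (hx : x < i * spacing n₂) {k : Fin n₁} (hk : i ≤ k.1) :
    x + witness n₁ n₂ n₃ (.b₁ k) < 0 := by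
  have h : (i : ℝ) * spacing n₂ ≤ k * spacing n₂ := by
    have : (i : ℝ) ≤ k := by exact_mod_cast hk
    unfold spacing; gcongr
  rw [add_witness_b₁_eq]
  linarith

lemma lt_add_witness_b₁ {x : ℝ} {i : ℕ} (hx : (i - 1) * spacing n₂ < x) {k : Fin n₁}
    (hk : k.1 < i) : 0 < x + witness n₁ n₂ n₃ (.b₁ k) := by
  have h : (k : ℝ) * spacing n₂ ≤ (i - 1) * spacing n₂ := by
    have : (k : ℝ) + 1 ≤ i := by exact_mod_cast hk
    have : (k : ℝ) ≤ i - 1 := by linarith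
    unfold spacing; gcongr
  rw [add_witness_b₁_eq]
  linarith

lemma act₁_witness {x : ℝ} {i : ℕ} (h : (i - 1) * spacing n₂ < x) (h' : x < i * spacing n₂) :
    act₁ (witness n₁ n₂ n₃) x = initialPattern i := by
  ext1 k
  simp only [act₁, initialPattern, decide_eq_decide]
  refine ⟨fun hk => ?_, lt_add_witness_b₁ h⟩
  by_contra! hik
  exact (add_witness_b₁_lt h' hik).not_gt hk

lemma add_witness_b₁_ne_zero {x : ℝ} {i : ℕ} (h : (i - 1) * spacing n₂ < x)
    (h' : x < i * spacing n₂) (k : Fin n₁) : x + witness n₁ n₂ n₃ (.b₁ k) ≠ 0 := by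
  rcases lt_or_ge k.1 i with hk | hk
  · exact (lt_add_witness_b₁ h hk).ne'
  · exact (add_witness_b₁_lt h' hk).ne

/-- The zigzag function on its `i`-th segment. -/
lemma pre₂_witness {i : ℕ} (hi : i ≤ n₁) (t : ℝ) (j : Fin n₂) :
    pre₂ 1 (witness n₁ n₂ n₃) (initialPattern i) t j = (-1) ^ i * (t - crossing n₂ i j) := by
  induction i with
  | zero => simp [pre₂, initialPattern_zero, crossing, witness, sub_eq_add_neg]
  | succ i ih =>
    rw [pre₂_switch (k := ⟨i, hi⟩) (initialPattern_succ_of_ne ⟨i, hi⟩)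
      (initialPattern_succ_self ⟨i, hi⟩) (initialPattern_self ⟨i, hi⟩), ih (by omega)]
    simp only [witness, crossing, pow_succ]
    push_cast
    rcases neg_one_pow_cases i with h | h <;> rw [h] <;> ring

/-- The third layer as a function of the value `u` of the zigzag function. -/
lemma pre₃_witness {p₁ : Fin n₁ → Bool} {t u : ℝ}
    (h : ∀ j, pre₂ 1 (witness n₁ n₂ n₃) p₁ t j = u - knot n₂ j) {m : ℕ} (hm : m + 1 ≤ n₂)
    (r : Fin n₃) :
    pre₃ 1 1 (witness n₁ n₂ n₃) p₁ (initialPattern (m + 1)) t r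
      = (hiLevel r + loLevel n₁ n₂ r) / 2
        + (-1) ^ (m + 1) * (hiLevel r - loLevel n₁ n₂ r) * (u - knot n₂ (m + 1) + 1 / 2)
        + (t - u) := by
  induction m with
  | zero =>
    rw [pre₃_switch (j := ⟨0, hm⟩) (initialPattern_succ_of_ne ⟨0, hm⟩)
      (initialPattern_succ_self ⟨0, hm⟩) (initialPattern_self ⟨0, hm⟩), h]
    simp [pre₃, initialPattern_zero, witness, knot]
    ring
  | succ m ih =>
    rw [pre₃_switch (j := ⟨m + 1, hm⟩) (initialPattern_succ_of_ne ⟨m + 1, hm⟩)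
      (initialPattern_succ_self ⟨m + 1, hm⟩) (initialPattern_self ⟨m + 1, hm⟩), h,
      ih (by omega)]
    simp only [witness, Nat.succ_ne_zero, if_false, pow_succ, knot]
    push_cast
    ring

lemma pre₃_witness_zero (p₁ : Fin n₁ → Bool) (t : ℝ) (r : Fin n₃) :
    pre₃ 1 1 (witness n₁ n₂ n₃) p₁ (initialPattern 0) t r = t + (hiLevel r + n₂) := by
  simp [pre₃, initialPattern_zero, witness]

lemma pre₂_witness_crossing {i : ℕ} (hi : i ≤ n₁) (j j' : Fin n₂) :
    pre₂ 1 (witness n₁ n₂ n₃) (initialPattern i) (crossing n₂ i j) j'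
      = knot n₂ j - knot n₂ j' := by
  rw [pre₂_witness hi]
  unfold crossing
  rcases neg_one_pow_cases i with h | h <;> rw [h] <;> ring

lemma act₁_crossing (i : ℕ) (j : Fin n₂) :
    act₁ (witness n₁ n₂ n₃) (crossing n₂ i j) = initialPattern i :=
  act₁_witness (crossing_bounds i j.2).1 (crossing_bounds i j.2).2

/-- There the zigzag equals knot `j`, so exactly the lower knots are exceeded; bit `j` itself is off
because the inequality is strict. -/
lemma act₂_crossing {i : ℕ} (hi : i ≤ n₁) (j : Fin n₂) :
    act₂ 1 (witness n₁ n₂ n₃) (crossing n₂ i j) = initialPattern j := by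
  ext1 j'
  simp only [act₂, act₁_crossing, pre₂_witness_crossing hi, initialPattern, knot,
    sub_sub_sub_cancel_right, sub_pos, Nat.cast_lt]

lemma pre₃_crossing {i : ℕ} (hi : i ≤ n₁) (j : Fin n₂) (r : Fin n₃) :
    pre₃ 1 1 (witness n₁ n₂ n₃) (act₁ (witness n₁ n₂ n₃) (crossing n₂ i j))
      (act₂ 1 (witness n₁ n₂ n₃) (crossing n₂ i j)) (crossing n₂ i j) r
      = (if Even j.1 then hiLevel r else loLevel n₁ n₂ r) + (crossing n₂ i j - knot n₂ j) := by
  rw [act₁_crossing, act₂_crossing hi]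
  obtain ⟨_ | m, hm⟩ := j
  · simp only [pre₃_witness_zero, knot, Even.zero, if_true]
    push_cast
    ring
  · rw [pre₃_witness (fun j' => pre₂_witness_crossing hi _ j') (by omega)]
    split_ifs with he
    · rw [he.neg_one_pow]
      ring
    · rw [(Nat.not_even_iff_odd.1 he).neg_one_pow]
      ring

lemma pre₃_crossing_pos {i : ℕ} (hi : i ≤ n₁) (j : Fin n₂) {r : Fin n₃}
    (h : r.1 = 0 ∨ Even j.1) :
    0 < pre₃ 1 1 (witness n₁ n₂ n₃) (act₁ (witness n₁ n₂ n₃) (crossing n₂ i j))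
      (act₂ 1 (witness n₁ n₂ n₃) (crossing n₂ i j)) (crossing n₂ i j) r := by
  rw [pre₃_crossing hi]
  have h1 := knot_le_crossing i j.2
  have h2 := hiLevel_pos r
  split_ifs with he
  · linarith
  · simp only [loLevel, h.resolve_right he, if_true]
    linarith

/-- The depth beats the drift t - φ(t), which at a crossing is below (n₁ + 1) * spacing. -/
lemma pre₃_crossing_neg {i : ℕ} (hi : i ≤ n₁) (j : Fin n₂) {r : Fin n₃}
    (h : ¬(r.1 = 0 ∨ Even j.1)) :
    pre₃ 1 1 (witness n₁ n₂ n₃) (act₁ (witness n₁ n₂ n₃) (crossing n₂ i j))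
      (act₂ 1 (witness n₁ n₂ n₃) (crossing n₂ i j)) (crossing n₂ i j) r < 0 := by
  rw [not_or] at h
  rw [pre₃_crossing hi, if_neg h.2, loLevel, if_neg h.1]
  have h1 := (crossing_bounds i j.2).2
  have h2 : (0 : ℝ) ≤ j.1 := Nat.cast_nonneg _
  have h3 : (i : ℝ) * spacing n₂ ≤ n₁ * spacing n₂ := by
    have : (i : ℝ) ≤ n₁ := by exact_mod_cast hi
    unfold spacing; gcongr
  unfold depth knot
  have h4 : spacing n₂ = n₂ + 1 := rfl
  nlinarith

/-- The pattern does not depend on the segment `i`, so all crossings of one knot give relations with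
the same coefficients. Neuron 0 is always active and transmits the kink. -/
lemma act₃_crossing {i : ℕ} (hi : i ≤ n₁) (j : Fin n₂) :
    act₃ 1 1 (witness n₁ n₂ n₃) (crossing n₂ i j)
      = fun r => decide (r.1 = 0 ∨ Even j.1) := by
  ext1 r
  simp only [act₃, decide_eq_decide]
  refine ⟨fun h => ?_, pre₃_crossing_pos hi j⟩
  by_contra hr
  exact (pre₃_crossing_neg hi j hr).not_gt h

lemma pre₃_crossing_ne_zero {i : ℕ} (hi : i ≤ n₁) (j : Fin n₂) (r : Fin n₃) :
    pre₃ 1 1 (witness n₁ n₂ n₃) (act₁ (witness n₁ n₂ n₃) (crossing n₂ i j))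
      (act₂ 1 (witness n₁ n₂ n₃) (crossing n₂ i j)) (crossing n₂ i j) r ≠ 0 := by
  by_cases h : r.1 = 0 ∨ Even j.1
  · exact (pre₃_crossing_pos hi j h).ne'
  · exact (pre₃_crossing_neg hi j h).ne

/-- The sign depends on `j` only, so the weights of active neurons cannot cancel. -/
lemma witness_A₃_sign (r : Fin n₃) (j : Fin n₂) :
    0 < (-1) ^ (j.1 + 1) * witness n₁ n₂ n₃ (.A₃ r j) := by
  have h := loLevel_lt_hiLevel (n₁ := n₁) (n₂ := n₂) r
  simp only [witness]
  split_ifs with hj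
  · rw [hj, zero_add, pow_one]
    linarith
  · rcases neg_one_pow_cases j with h' | h' <;> rw [pow_succ, h'] <;> linarith

/-- Total weight of the active outputs of the `j`-th neuron of the second layer at its kinks. -/
lemma sum_witness_A₃_ne_zero (hn₃ : 1 ≤ n₃) (j : Fin n₂) :
    ∑ r : Fin n₃, gate (decide (r.1 = 0 ∨ Even j.1))
      * (witness n₁ n₂ n₃ (.A₄ r) * witness n₁ n₂ n₃ (.A₃ r j)) ≠ 0 := by
  have hsign : 0 < (-1) ^ (j.1 + 1) * ∑ r : Fin n₃, gate (decide (r.1 = 0 ∨ Even j.1))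
      * (witness n₁ n₂ n₃ (.A₄ r) * witness n₁ n₂ n₃ (.A₃ r j)) := by
    rw [Finset.mul_sum]
    refine Finset.sum_pos' (fun r _ => ?_) ⟨⟨0, hn₃⟩, Finset.mem_univ _, ?_⟩
    · have := witness_A₃_sign (n₁ := n₁) r j
      by_cases h : r.1 = 0 ∨ Even j.1
      · simpa [h, show witness n₁ n₂ n₃ (.A₄ r) = 1 from rfl] using this.le
      · simp [h]
    · simpa [show witness n₁ n₂ n₃ (.A₄ ⟨0, hn₃⟩) = 1 from rfl]
        using witness_A₃_sign (n₁ := n₁) (⟨0, hn₃⟩ : Fin n₃) j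
  exact right_ne_zero_of_mul hsign.ne'

/-! ### Kinks of the third layer on the negative axis -/

/-- Inputs to the left of all kinks of the first layer. -/
lemma act₁_witness_of_neg {x : ℝ} (hx : x < 0) :
    act₁ (witness n₁ n₂ n₃) x = initialPattern 0 := by
  ext1 k
  have := add_witness_b₁_lt (n₁ := n₁) (n₂ := n₂) (n₃ := n₃) (i := 0) (x := x) (by simpa using hx) k.1.zero_le
  simp [act₁, initialPattern, this.le.not_gt]

lemma pre₂_witness_zero (t : ℝ) (j : Fin n₂) :
    pre₂ 1 (witness n₁ n₂ n₃) (initialPattern 0) t j = t - knot n₂ j := by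
  rw [pre₂_witness n₁.zero_le]
  simp [crossing]

/-- The zero of the `r`-th neuron of the third layer to the left of the `m`-th knot. -/
noncomputable def zeroLeft (n₁ n₂ : ℕ) (r : ℕ) : ℕ → ℝ
  | 0 => knot n₂ 0 - hiLevel r
  | m + 1 => knot n₂ (m + 1) - 1 / 2
      - (-1) ^ (m + 1) * (hiLevel r + loLevel n₁ n₂ r) / (2 * (hiLevel r - loLevel n₁ n₂ r))

/-- Neuron 0 is excluded for m ≠ 0: both its levels are positive, so it has no zero between knots.
For the others the levels have opposite signs, and |hi - depth| < hi + depth keeps the zero within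
1/2 of the midpoint. -/
lemma zeroLeft_bounds {r m : ℕ} (hr : m ≠ 0 → r ≠ 0) :
    zeroLeft n₁ n₂ r m < knot n₂ m ∧ ∀ j < m, knot n₂ j < zeroLeft n₁ n₂ r m := by
  have h1 := hiLevel_pos r
  rcases m with _ | m
  · simpa [zeroLeft] using h1
  · have h2 := depth_pos (n₁ := n₁) (n₂ := n₂)
    have h3 : |(-1) ^ (m + 1) * (hiLevel r + loLevel n₁ n₂ r)
        / (2 * (hiLevel r - loLevel n₁ n₂ r))| < 1 / 2 := by
      rw [loLevel, if_neg (hr (Nat.succ_ne_zero m)), abs_div, abs_mul, abs_neg_one_pow, one_mul,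
        abs_of_pos (show 0 < 2 * (hiLevel r - -depth n₁ n₂) by linarith),
        div_lt_iff₀ (by linarith), abs_lt]
      constructor <;> linarith
    rw [abs_lt] at h3
    simp only [zeroLeft]
    refine ⟨by linarith, fun j hj => ?_⟩
    have : (j : ℝ) ≤ m := by exact_mod_cast Nat.lt_succ_iff.1 hj
    have : knot n₂ j ≤ knot n₂ (m + 1) - 1 := by
      unfold knot
      push_cast
      linarith
    linarith

lemma zeroLeft_neg {r m : ℕ} (hr : m ≠ 0 → r ≠ 0) (hm : m ≤ n₂) : zeroLeft n₁ n₂ r m < 0 := by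
  have h1 := (zeroLeft_bounds (n₁ := n₁) (n₂ := n₂) hr).1
  have h2 : (m : ℝ) ≤ n₂ := by exact_mod_cast hm
  unfold knot at h1
  linarith

lemma pre₂_zeroLeft_ne_zero {r m : ℕ} (hr : m ≠ 0 → r ≠ 0) (j : Fin n₂) :
    pre₂ 1 (witness n₁ n₂ n₃) (initialPattern 0) (zeroLeft n₁ n₂ r m) j ≠ 0 := by
  rw [pre₂_witness_zero]
  have h := zeroLeft_bounds (n₁ := n₁) (n₂ := n₂) hr
  rcases lt_or_ge j.1 m with hj | hj
  · linarith [h.2 j hj]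
  · have : knot n₂ m ≤ knot n₂ j := by
      unfold knot
      gcongr
    linarith [h.1]

lemma act₂_zeroLeft {r m : ℕ} (hr : m ≠ 0 → r ≠ 0) (hm : m ≤ n₂) :
    act₂ 1 (witness n₁ n₂ n₃) (zeroLeft n₁ n₂ r m) = initialPattern m := by
  have h := zeroLeft_bounds (n₁ := n₁) (n₂ := n₂) hr
  ext1 j
  simp only [act₂, act₁_witness_of_neg (zeroLeft_neg hr hm), pre₂_witness_zero, initialPattern,
    decide_eq_decide, sub_pos]
  refine ⟨fun hj => ?_, h.2 j⟩
  by_contra! hmj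
  have : knot n₂ m ≤ knot n₂ j := by
    unfold knot
    gcongr
  linarith [h.1]

/-- The affine function that the `r`-th neuron of the third layer computes near `zeroLeft`. -/
lemma pre₃_zeroLeft {r : Fin n₃} {m : ℕ} (hm : m ≤ n₂) (t : ℝ) :
    pre₃ 1 1 (witness n₁ n₂ n₃) (initialPattern 0) (initialPattern m) t r
      = (if m = 0 then 1 else (-1) ^ m * (hiLevel r - loLevel n₁ n₂ r))
        * (t - zeroLeft n₁ n₂ r m) := by
  rcases m with _ | m
  · simp [pre₃_witness_zero, zeroLeft, knot]
    ring
  · rw [pre₃_witness (fun j => pre₂_witness_zero t j) hm, if_neg (Nat.succ_ne_zero m)]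
    simp only [zeroLeft]
    have h : hiLevel r - loLevel n₁ n₂ r ≠ 0 := (sub_pos.2 (loLevel_lt_hiLevel _)).ne'
    rcases neg_one_pow_cases (m + 1) with he | he <;> rw [he] <;> field_simp <;> ring

lemma pre₃_zeroLeft_ne_zero {r r' : Fin n₃} {m : ℕ} (hr : m ≠ 0 → r.1 ≠ 0) (hm : m ≤ n₂)
    (hrr : r' ≠ r) :
    pre₃ 1 1 (witness n₁ n₂ n₃) (initialPattern 0) (initialPattern m) (zeroLeft n₁ n₂ r m) r'
      ≠ 0 := by
  have hne : hiLevel r' ≠ hiLevel r := fun h => hrr (Fin.ext (by simpa [hiLevel] using h))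
  have h' := (sub_pos.2 (loLevel_lt_hiLevel (n₁ := n₁) (n₂ := n₂) r')).ne'
  have h := (sub_pos.2 (loLevel_lt_hiLevel (n₁ := n₁) (n₂ := n₂) r)).ne'
  rw [pre₃_zeroLeft hm]
  rcases m with _ | m
  · simpa [zeroLeft, sub_eq_zero] using hne
  · rw [if_neg (Nat.succ_ne_zero m)]
    refine mul_ne_zero (mul_ne_zero (by simp) h') ?_
    have hr0 := hr (Nat.succ_ne_zero m)
    -- Two zeros between the same knots coincide only if the ratios of high to low level agree.
    have hdet : hiLevel r * loLevel n₁ n₂ r' - hiLevel r' * loLevel n₁ n₂ r ≠ 0 := by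
      have hd := depth_pos (n₁ := n₁) (n₂ := n₂)
      have hp := hiLevel_pos r
      have hp' := hiLevel_pos r'
      simp only [loLevel, hr0, if_false]
      split_ifs
      · have := mul_pos hp' hd
        linarith
      · have := mul_ne_zero hd.ne' (sub_ne_zero.2 hne)
        intro hcon
        exact this (by linear_combination hcon)
    intro hcon
    refine hdet ?_
    simp only [zeroLeft] at hcon
    rcases neg_one_pow_cases (m + 1) with he | he <;> rw [he] at hcon <;> field_simp at hcon <;>
      linarith

end Witness

/-! ### Infinitesimal identifiability at the witness -/

section Identifiable

variable {n₁ n₂ n₃ : ℕ}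

lemma eq_zero_of_forall_mul_sub_add {a b x : ℝ} (h : ∀ t : ℝ, a * (t - x) + b = 0) :
    a = 0 ∧ b = 0 := by
  have h1 := h x
  have h2 := h (x + 1)
  constructor <;> linarith

/-- The derivative of the network in the parameters is injective at the witness. -/
theorem eq_zero_of_dgatedNetwork_witness (hn₂ : 1 ≤ n₂) (hn₃ : 1 ≤ n₃)
    (v : RealParam n₁ n₂ n₃ → ℝ)
    (hv : ∀ t, IsRegularInput 1 1 (witness n₁ n₂ n₃) t →
      dgatedNetwork 1 1 (witness n₁ n₂ n₃) v (act₁ (witness n₁ n₂ n₃) t)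
        (act₂ 1 (witness n₁ n₂ n₃) t) (act₃ 1 1 (witness n₁ n₂ n₃) t) t = 0) :
    v = 0 := by
  set θ := witness n₁ n₂ n₃ with hθ
  have kink₂ : ∀ i ≤ n₁, ∀ (j : Fin n₂) (t : ℝ),
      (∑ r : Fin n₃, gate (decide (r.1 = 0 ∨ Even j.1))
          * (v (.A₄ r) * θ (.A₃ r j) + θ (.A₄ r) * v (.A₃ r j)))
          * ((-1) ^ i * (t - crossing n₂ i j))
        + (∑ r : Fin n₃, gate (decide (r.1 = 0 ∨ Even j.1)) * (θ (.A₄ r) * θ (.A₃ r j)))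
          * dpre₂ θ v (initialPattern i) t j = 0 := fun i hi j t => by
    have hb := crossing_bounds i j.2
    have := kink₂_relation hv (x := crossing n₂ i j) (a := (-1) ^ i) (j := j) (by simp)
      (add_witness_b₁_ne_zero hb.1 hb.2)
      (fun t => by rw [act₁_crossing, pre₂_witness hi])
      (fun j' hj => by
        rw [act₁_crossing, pre₂_witness_crossing hi]
        simpa [knot, sub_eq_zero, Fin.val_inj] using hj.symm)
      (pre₃_crossing_ne_zero hi j) t
    rwa [act₁_crossing, act₃_crossing hi] at this
  have hM := fun j => sum_witness_A₃_ne_zero (n₁ := n₁) (n₂ := n₂) hn₃ j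
  have hbC : ∀ j : Fin n₂, (∑ r : Fin n₃, gate (decide (r.1 = 0 ∨ Even j.1))
      * (v (.A₄ r) * θ (.A₃ r j) + θ (.A₄ r) * v (.A₃ r j))) = 0 ∧ v (.b₂ j) = 0 := fun j => by
    -- On segment 0 no first-layer neuron is active, so `dpre₂` is the constant `v (.b₂ j)`.
    have h := eq_zero_of_forall_mul_sub_add fun t => by
      simpa [dpre₂, initialPattern_zero, -Bool.decide_or] using kink₂ 0 n₁.zero_le j t
    exact ⟨h.1, (mul_eq_zero.1 h.2).resolve_left (hM j)⟩
  have hdpre₂ : ∀ i ≤ n₁, ∀ (j : Fin n₂) (t : ℝ), dpre₂ θ v (initialPattern i) t j = 0 :=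
    fun i hi j t => by
      have h := kink₂ i hi j t
      rw [(hbC j).1, zero_mul, zero_add] at h
      exact (mul_eq_zero.1 h).resolve_left (hM j)
  have hAb : ∀ (k : Fin n₁) (j : Fin n₂), v (.A₂ j k) = 0 ∧ v (.b₁ k) = 0 := fun k j => by
    -- `dpre₂` vanishes on both segments adjacent to kink `k`; their difference involves only neuron
    -- `k`.
    have h := eq_zero_of_forall_mul_sub_add (a := v (.A₂ j k)) (b := θ (.A₂ j k) * v (.b₁ k))
      (x := -θ (.b₁ k)) fun t => by
        have h := dpre₂_switch (initialPattern_succ_of_ne k) (initialPattern_succ_self k)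
          (initialPattern_self k) θ v t j
        rw [hdpre₂ _ k.2, hdpre₂ _ k.2.le] at h
        rw [sub_neg_eq_add]
        linarith
    exact ⟨h.1, (mul_eq_zero.1 h.2).resolve_left (by simp [hθ, witness])⟩
  have hb₁ : ∀ k, v (.b₁ k) = 0 := fun k => (hAb k ⟨0, hn₂⟩).2
  have hA₂ : ∀ j k, v (.A₂ j k) = 0 := fun j k => (hAb k j).1
  have hb₂ : ∀ j, v (.b₂ j) = 0 := fun j => (hbC j).2
  have hd₂ : ∀ p t j, dpre₂ θ v p t j = 0 := fun p t j => by simp [dpre₂, hb₁, hA₂, hb₂]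
  have kink₃ : ∀ (r : Fin n₃) (m : ℕ), (m ≠ 0 → r.1 ≠ 0) → m ≤ n₂ → ∀ t : ℝ,
      v (.A₄ r) * ((if m = 0 then 1 else (-1) ^ m * (hiLevel r - loLevel n₁ n₂ r))
        * (t - zeroLeft n₁ n₂ r m))
        + dpre₃ 1 θ v (initialPattern 0) (initialPattern m) t r = 0 := fun r m hr hm t => by
    have ha₁ : act₁ θ (zeroLeft n₁ n₂ r m) = initialPattern 0 :=
      act₁_witness_of_neg (zeroLeft_neg hr hm)
    have ha₂ : act₂ 1 θ (zeroLeft n₁ n₂ r m) = initialPattern m := act₂_zeroLeft hr hm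
    have := kink₃_relation hv (x := zeroLeft n₁ n₂ r m)
      (a := if m = 0 then 1 else (-1) ^ m * (hiLevel r - loLevel n₁ n₂ r)) (r := r)
      (by
        have := (sub_pos.2 (loLevel_lt_hiLevel (n₁ := n₁) (n₂ := n₂) r)).ne'
        split_ifs
        · simp
        · exact mul_ne_zero (by simp) this)
      (fun k => (add_witness_b₁_lt (i := 0) (by simpa using zeroLeft_neg hr hm)
        k.1.zero_le).ne)
      (fun j => by rw [ha₁]; exact pre₂_zeroLeft_ne_zero hr j)
      (fun t => by rw [ha₁, ha₂]; exact pre₃_zeroLeft hm t)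
      (fun r' hr' => by rw [ha₁, ha₂]; exact pre₃_zeroLeft_ne_zero hr hm hr') t
    rwa [ha₁, ha₂, show θ (.A₄ r) = 1 from rfl, one_mul] at this
  have hAb₃ : ∀ r, v (.A₄ r) = 0 ∧ v (.b₃ r) = 0 := fun r =>
    eq_zero_of_forall_mul_sub_add fun t => by
      simpa [dpre₃, initialPattern_zero] using kink₃ r 0 (by simp) n₂.zero_le t
  have hA₄ : ∀ r, v (.A₄ r) = 0 := fun r => (hAb₃ r).1
  have hb₃ : ∀ r, v (.b₃ r) = 0 := fun r => (hAb₃ r).2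
  have hA₃ne : ∀ (r : Fin n₃) (j : Fin n₂), r.1 ≠ 0 → v (.A₃ r j) = 0 := fun r j hr => by
    have hd : ∀ m ≤ n₂, ∀ t, dpre₃ 1 θ v (initialPattern 0) (initialPattern m) t r = 0 :=
      fun m hm t => by simpa [hA₄] using kink₃ r m (fun _ => hr) hm t
    -- The input is chosen so that `pre₂` equals 1.
    have h := dpre₃_switch (initialPattern_succ_of_ne j) (initialPattern_succ_self j)
      (initialPattern_self j) 1 θ v (initialPattern 0) (knot n₂ j + 1) r
    rw [hd _ j.2, hd _ j.2.le, hd₂, pre₂_witness_zero] at h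
    linarith
  have hA₃ : ∀ r j, v (.A₃ r j) = 0 := fun r j => by
    by_cases hr : r.1 = 0
    -- Neuron 0 lacks kinks between knots, but the second-layer relation has only its entry left.
    · have h := (hbC j).1
      rw [Finset.sum_eq_single r] at h
      · simpa [hA₄, hr, show θ (.A₄ r) = 1 from rfl] using h
      · intro r' _ hr'
        rw [hA₄, hA₃ne r' j fun h0 => hr' (Fin.ext (h0.trans hr.symm))]
        simp
      · simp
    · exact hA₃ne r j hr
  have hcb : v .c₄ = 0 ∧ v .b₄ = 0 := by
    refine eq_zero_of_forall_mul_sub_add (x := 0) fun t => ?_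
    have hb := crossing_bounds 0 hn₂
    -- With all other coordinates zero, the derivative on any piece is `t * v .c₄ + v .b₄`.
    have h := dgatedNetwork_eq_zero_of_kink₂ hv (x := crossing n₂ 0 0) (a := 1) (j := ⟨0, hn₂⟩)
      one_ne_zero (add_witness_b₁_ne_zero hb.1 hb.2)
      (fun t => by
        rw [act₁_crossing 0 (⟨0, hn₂⟩ : Fin n₂), pre₂_witness n₁.zero_le, pow_zero])
      (fun j' hj => by
        rw [act₁_crossing 0 (⟨0, hn₂⟩ : Fin n₂),
          pre₂_witness_crossing n₁.zero_le (⟨0, hn₂⟩ : Fin n₂)]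
        simpa [knot, sub_eq_zero, Fin.ext_iff, eq_comm] using hj)
      (pre₃_crossing_ne_zero n₁.zero_le (⟨0, hn₂⟩ : Fin n₂)) true t
    simp only [dgatedNetwork, dpre₃, hd₂, hA₃, hb₃, hA₄] at h
    simp only [zero_mul, mul_zero, add_zero, Finset.sum_const_zero, zero_add] at h
    linarith
  funext p
  cases p with
  | b₁ k => exact hb₁ k
  | A₂ j k => exact hA₂ j k
  | b₂ j => exact hb₂ j
  | A₃ r j => exact hA₃ r j
  | b₃ r => exact hb₃ r
  | A₄ r => exact hA₄ r
  | c₄ => exact hcb.1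
  | b₄ => exact hcb.2

end Identifiable

theorem theorem4p5 (n₁ n₂ n₃ : ℕ) (hn₁ : 1 ≤ n₁) (hn₂ : 1 ≤ n₂) (hn₃ : 1 ≤ n₃) :
    (∀ f ∈ reluModel n₁ n₂ n₃,
      ∃ (s₂ : Fin n₂ → SignType) (s₃ : Fin n₃ → SignType) (θ : RealParam n₁ n₂ n₃ → ℝ),
        f = normalizedNetwork s₂ s₃ θ) ∧
    Nat.card (RealParam n₁ n₂ n₃) = n₁ + (n₁ + 1) * n₂ + (n₂ + 1) * n₃ + n₃ + 2 ∧
    (∀ (S : Set (RealParam n₁ n₂ n₃)) (v : S → ℝ), S.Nonempty →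
      restrictedModel S v ⊂ reluModel n₁ n₂ n₃) :=
  ⟨fun _ hf => exists_eq_normalizedNetwork hf, RealParam.card_eq, fun _ v hS =>
    restrictedModel_ssubset (eq_zero_of_dgatedNetwork_witness hn₂ hn₃) hS v⟩
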